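/- Let $A$ be an $n\times m$ matrix over a field $F$, let $H_e=\{x\in F^m: x_e=0\}$ ($e\in[m]$) be the coordinate hyperplanes, $\mathcal H_m=\{H_e:e\in[m]\}$, and let $U=\operatorname{Row}A$ and $Z=\operatorname{Nul}A$ be the row space and the null space of $A$ in $F^m$. For a subspace $S\subseteq F^m$ the induced arrangement is $\mathcal H_m^S=\{H_e\cap S: H_e\not\supseteq S\}$; the labelled induced arrangement is the family $(H_e\cap S)_{e\in[m]}$, in which repetitions and degenerate members $H_e\cap S=S$ are kept. The matroid of an arrangement in $S$ (labelled or not) has the set of hyperplanes (respectively the set of labels) as ground set, and the rank of a subset is the codimension in $S$ of its intersection. The intersection lattice $\mathcal L(\mathcal H_m^S)$ is the set of all intersections of members of $\mathcal H_m^S$ (the empty intersection being $S$), ordered by reverse inclusion. $M(A)$ is the matroid on $[m]$ of linear dependence of the columns of $A$, $N(U)$ is the chain-group matroid of $U$, that is, the matroid on $[m]$ whose circuits are the minimal nonempty supports of vectors in $U$, and $\operatorname{Lat}M$ is the lattice of closed sets of a matroid $M$, ordered by inclusion. (a) The map $e\mapsto H_e\cap U$ is a matroid isomorphism from $M(A)$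 to the matroid of the labelled arrangement induced in $U$. In terms of the set $\mathcal H_m^U$: a set $I\subseteq[m]$ is independent in $M(A)$ if and only if $e\mapsto H_e\cap U$ is injective on $I$ and its image is an independent set of $M(\mathcal H_m^U)$. (So $e$ is a loop of $M(A)$ exactly when $H_e\supseteq U$, and two nonloops are parallel exactly when they induce the same hyperplane; if there are no such elements, the map is an isomorphism of $M(A)$ with $M(\mathcal H_m^U)$.) In the same two senses $e\mapsto H_e\cap Z$ is a matroid isomorphism from $N(U)$ to the matroid of the arrangement induced in $Z$. Moreover $N(U)$ is the dual matroid of $M(A)$. (b) The map $S\mapsto E_U(S):=\{e\in[m]:H_e\supseteq S\}$ is an order isomorphism from $\mathcal L(\mathcal H_m^U)$ to $\operatorname{Lat}M(A)$, namely the one induced by the first map in (a): its inverse is $X\mapsto\bigcap_{e\in X}(H_e\cap U)$, the empty intersection being $U$. Likewise $S\mapsto E_Z(S):=\{e\in[m]:H_e\supseteq S\}$ is an order isomorphism from $\mathcal L(\mathcal H_m^Z)$ to $\operatorname{Lat}N(U)$, with inverse $X\mapsto\bigcap_{e\in X}(H_e\cap Z)$, the empty intersection being $Z$. (c) Suppose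 that $F$ is an ordered field. The regions of an arrangement in $S$ are the components of the complement in $S$ of the union of its members, where two points lie in the same component if they are joined by a polygonal path in that complement (over $\mathbb R$ these are the connected components). Let $\mathcal M(A)$ be the oriented matroid of columns of $A$, whose signed circuits are the sign patterns of the vectors of minimal nonempty support in $Z$. Its orientations are indexed by the $2^m$ sets $T\subseteq[m]$, $T$ giving the reorientation of $\mathcal M(A)$ in which the elements of $T$ are reversed; an orientation is acyclic if it has no positive circuit, and totally cyclic if every element is in a positive circuit. Then the regions of the labelled arrangement induced in $U$ correspond bijectively to the acyclic orientations, and those of the labelled arrangement induced in $Z$ correspond bijectively to the totally cyclic orientations. In both cases a region $R$ corresponds to $T=\{e: x_e<0\text{ for all }x\in R\}=\{e:x_e<0\text{ for some }x\in R\}$. (In particular there are no regions if some $H_e$ contains the subspace.) If no $H_e$ contains $U$ (respectively $Z$), the same holds for the regions of $\mathcal H_m^U$ (respectively $\mathcal H_m^Z$). -/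

import Mathlib

open Set

/-! ## Hyperplane arrangements and their matroids -/

section LinearMatroids

/-- The matroid of linear dependence of a family of vectors `v` indexed by a finite set `E`. -/
def linearMatroid (F : Type*) {ι W : Type*} [Field F] [AddCommGroup W] [Module F W]
    (v : ι → W) (E : Set ι) (hE : E.Finite) : Matroid ι :=
  (IndepMatroid.ofFinite hE (fun I => I ⊆ E ∧ LinearIndepOn F v I)
    ⟨empty_subset _, linearIndepOn_empty F v⟩
    (fun _ _ hJ hIJ => ⟨hIJ.trans hJ.1, hJ.2.mono hIJ⟩)
    (by
      rintro I J ⟨hI, hIv⟩ ⟨hJ, hJv⟩ hlt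
      have hIf := hE.subset hI
      have hJf := hE.subset hJ
      have hnot : ¬ (∀ e ∈ J, v e ∈ Submodule.span F (v '' I)) := by
        intro h
        have hle : Submodule.span F (v '' J) ≤ Submodule.span F (v '' I) := by
          rw [Submodule.span_le]; rintro _ ⟨e, he, rfl⟩; exact h e he
        have hfd : FiniteDimensional F (Submodule.span F (v '' I)) :=
          FiniteDimensional.span_of_finite F (hIf.image v)
        have h1 := Submodule.finrank_mono hle
        have key : ∀ K : Set ι, K.Finite → LinearIndepOn F v K →
            Module.finrank F (Submodule.span F (v '' K)) = K.ncard := by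
          intro K hK hKv
          have := hK.fintype
          have h2 := finrank_span_eq_card (R := F) (b := fun x : K => v x) hKv
          have h3 : Set.range (fun x : K => v x) = v '' K := by
            ext; simp
          rw [h3] at h2
          rw [h2, Set.ncard_eq_toFinset_card', Set.toFinset_card]
        rw [key J hJf hJv, key I hIf hIv] at h1
        omega
      push Not at hnot
      obtain ⟨e, heJ, he⟩ := hnot
      have heI : e ∉ I := fun h => he (Submodule.subset_span (mem_image_of_mem v h))
      exact ⟨e, heJ, heI, insert_subset (hJ heJ) hI, (linearIndepOn_insert heI).2 ⟨hIv, he⟩⟩)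
    (fun _ h => h.1)).matroid

@[simp] theorem linearMatroid_indep_iff {F ι W : Type*} [Field F] [AddCommGroup W] [Module F W]
    (v : ι → W) (E : Set ι) (hE : E.Finite) (I : Set ι) :
    (linearMatroid F v E hE).Indep I ↔ I ⊆ E ∧ LinearIndepOn F v I := by
  simp [linearMatroid, IndepMatroid.ofFinite]

@[simp] theorem linearMatroid_ground {F ι W : Type*} [Field F] [AddCommGroup W] [Module F W]
    (v : ι → W) (E : Set ι) (hE : E.Finite) : (linearMatroid F v E hE).E = E := by
  simp [linearMatroid, IndepMatroid.ofFinite]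

/-- The column matroid `M(A)` on the set of column indices. -/
def columnMatroid {F : Type*} [Field F] {n m : ℕ} (A : Matrix (Fin n) (Fin m) F) :
    Matroid (Fin m) :=
  linearMatroid F (fun e => A.col e) univ finite_univ

theorem finrank_span_image_eq_ncard_iff {F ι W : Type*} [Field F] [AddCommGroup W] [Module F W]
    (v : ι → W) {I : Set ι} (hI : I.Finite) :
    Module.finrank F (Submodule.span F (v '' I)) = I.ncard ↔ LinearIndepOn F v I := by
  have := hI.fintype
  have h3 : Set.range (fun x : I => v x) = v '' I := by ext; simp
  rw [LinearIndepOn, linearIndependent_iff_card_eq_finrank_span, h3,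
    Set.ncard_eq_toFinset_card', Set.toFinset_card, Set.finrank, eq_comm]

/-- The codimension of a subspace. -/
noncomputable def codim {F V : Type*} [Field F] [AddCommGroup V] [Module F V]
    (W : Submodule F V) : ℕ := Module.finrank F (V ⧸ W)

theorem exists_ker_eq {F V : Type*} [Field F] [AddCommGroup V] [Module F V]
    (W : Submodule F V) (hW : W = ⊤ ∨ IsCoatom W) :
    ∃ f : Module.Dual F V, LinearMap.ker f = W := by
  rcases hW with rfl | hW
  · exact ⟨0, LinearMap.ker_zero⟩
  · obtain ⟨f, hf, hle⟩ := Submodule.exists_le_ker_of_lt_top W hW.lt_top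
    refine ⟨f, ?_⟩
    rcases hW.le_iff.1 hle with h | h
    · exact absurd (LinearMap.ker_eq_top.1 h) hf
    · exact h

theorem codim_iInf_ker {F V ι : Type*} [Field F] [AddCommGroup V] [Module F V]
    [FiniteDimensional F V] (f : ι → Module.Dual F V) (I : Set ι) :
    codim (⨅ i ∈ I, LinearMap.ker (f i)) = Module.finrank F (Submodule.span F (f '' I)) := by
  have h : (⨅ i ∈ I, LinearMap.ker (f i)) = (Submodule.span F (f '' I)).dualCoannihilator := by
    apply SetLike.coe_injective
    rw [Submodule.coe_dualCoannihilator_span]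
    ext x; simp
  rw [h, codim]
  have h1 := Submodule.finrank_quotient_add_finrank (Submodule.span F (f '' I)).dualCoannihilator
  have h2 := Subspace.finrank_add_finrank_dualCoannihilator_eq (Submodule.span F (f '' I))
  omega

theorem exists_codim_matroid {F V ι : Type*} [Field F] [AddCommGroup V] [Module F V]
    [FiniteDimensional F V] (K : ι → Submodule F V) (E : Set ι) (hE : E.Finite)
    (hK : ∀ e ∈ E, K e = ⊤ ∨ IsCoatom (K e)) :
    ∃ M : Matroid ι, M.E = E ∧ (∀ I, M.Indep I ↔ I ⊆ E ∧ codim (⨅ e ∈ I, K e) = I.ncard) ∧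
      ∀ X ⊆ E, M.eRk X = (codim (⨅ e ∈ X, K e) : ℕ∞) := by
  choose! f hf using fun e (he : e ∈ E) => exists_ker_eq (K e) (hK e he)
  have hcod : ∀ X ⊆ E, codim (⨅ e ∈ X, K e) = Module.finrank F (Submodule.span F (f '' X)) := by
    intro X hX
    rw [← codim_iInf_ker]
    congr 1
    exact iInf_congr fun e => iInf_congr fun he => (hf e (hX he)).symm
  refine ⟨linearMatroid F f E hE, by simp, ?_, ?_⟩
  · intro I
    rw [linearMatroid_indep_iff]
    refine and_congr_right fun hI => ?_
    rw [hcod I hI, finrank_span_image_eq_ncard_iff f (hE.subset hI)]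
  · intro X hX
    obtain ⟨I, hI⟩ := (linearMatroid F f E hE).exists_isBasis X (by simpa using hX)
    have hIX := hI.subset
    have hIi := (linearMatroid_indep_iff f E hE I).1 hI.indep
    rw [← hI.encard_eq_eRk, hcod X hX]
    have hspan : Submodule.span F (f '' X) = Submodule.span F (f '' I) := by
      apply le_antisymm
      · rw [Submodule.span_le]
        rintro _ ⟨e, he, rfl⟩
        by_contra hne
        have heI : e ∉ I := fun h => hne (Submodule.subset_span (mem_image_of_mem f h))
        have : (linearMatroid F f E hE).Indep (insert e I) :=
          (linearMatroid_indep_iff f E hE _).2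
            ⟨insert_subset (hX he) hIi.1, (linearIndepOn_insert heI).2 ⟨hIi.2, hne⟩⟩
        exact heI (hI.mem_of_insert_indep he this)
      · exact Submodule.span_mono (image_mono hIX)
    have hIf := hE.subset hIi.1
    rw [hspan, (finrank_span_image_eq_ncard_iff f hIf).2 hIi.2, hIf.cast_ncard_eq]

end LinearMatroids

section Arrangements

/-- A (homogeneous) hyperplane arrangement in `V`: a finite set of linear hyperplanes. -/
structure HypArrangement (F V : Type*) [Field F] [AddCommGroup V] [Module F V] where
  hyps : Set (Submodule F V)
  finite : hyps.Finite
  isCoatom : ∀ H ∈ hyps, IsCoatom H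

/-- A labelled arrangement: a family of hyperplanes indexed by `ι`, in which repetitions and
the degenerate hyperplane (the whole space) are permitted. -/
structure LabArrangement (F V ι : Type*) [Field F] [AddCommGroup V] [Module F V] where
  hyp : ι → Submodule F V
  eq_top_or_isCoatom : ∀ e, hyp e = ⊤ ∨ IsCoatom (hyp e)

/-- The matroid of an arrangement: the ground set is the set of hyperplanes, and the rank of a set
of hyperplanes is the codimension of its intersection (see `HypArrangement.eRk_matroid`). -/
noncomputable def HypArrangement.matroid {F V : Type*} [Field F] [AddCommGroup V] [Module F V]
    [FiniteDimensional F V] (𝓗 : HypArrangement F V) : Matroid (Submodule F V) :=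
  Matroid.ofExistsMatroid 𝓗.hyps
    (fun I => I ⊆ 𝓗.hyps ∧ codim (⨅ H ∈ I, H) = I.ncard)
    (by
      obtain ⟨M, h1, h2, -⟩ := exists_codim_matroid (fun H : Submodule F V => H) 𝓗.hyps 𝓗.finite
        (fun H hH => Or.inr (𝓗.isCoatom H hH))
      exact ⟨M, h1.symm, h2⟩)

/-- The matroid of a labelled arrangement: the ground set is the set of labels, and the rank of a
set of labels is the codimension of the intersection of the hyperplanes that they label
(see `LabArrangement.eRk_matroid`). -/
noncomputable def LabArrangement.matroid {F V ι : Type*} [Field F] [AddCommGroup V] [Module F V]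
    [FiniteDimensional F V] [Finite ι] (𝓚 : LabArrangement F V ι) : Matroid ι :=
  Matroid.ofExistsMatroid univ
    (fun I => codim (⨅ e ∈ I, 𝓚.hyp e) = I.ncard)
    (by
      obtain ⟨M, h1, h2, -⟩ := exists_codim_matroid 𝓚.hyp univ finite_univ
        (fun e _ => 𝓚.eq_top_or_isCoatom e)
      exact ⟨M, h1.symm, by simpa using h2⟩)

theorem HypArrangement.eRk_matroid {F V : Type*} [Field F] [AddCommGroup V] [Module F V]
    [FiniteDimensional F V] (𝓗 : HypArrangement F V) (𝓢 : Set (Submodule F V))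
    (h𝓢 : 𝓢 ⊆ 𝓗.hyps) : 𝓗.matroid.eRk 𝓢 = (codim (sInf 𝓢) : ℕ∞) := by
  obtain ⟨M, h1, h2, h3⟩ := exists_codim_matroid (fun H : Submodule F V => H) 𝓗.hyps 𝓗.finite
    (fun H hH => Or.inr (𝓗.isCoatom H hH))
  have : 𝓗.matroid = M := Matroid.ext_indep h1.symm fun I _ => (h2 I).symm
  rw [this, h3 𝓢 h𝓢, sInf_eq_iInf]

theorem LabArrangement.eRk_matroid {F V ι : Type*} [Field F] [AddCommGroup V] [Module F V]
    [FiniteDimensional F V] [Finite ι] (𝓚 : LabArrangement F V ι) (X : Set ι) :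
    𝓚.matroid.eRk X = (codim (⨅ e ∈ X, 𝓚.hyp e) : ℕ∞) := by
  obtain ⟨M, h1, h2, h3⟩ := exists_codim_matroid 𝓚.hyp univ finite_univ
    (fun e _ => 𝓚.eq_top_or_isCoatom e)
  have : 𝓚.matroid = M :=
    Matroid.ext_indep h1.symm fun I _ => by
      rw [h2 I, LabArrangement.matroid, Matroid.ofExistsMatroid]; simp
  rw [this, h3 X (subset_univ _)]

/-- The intersection lattice: all intersections of hyperplanes of the arrangement (the empty
intersection is the whole space), ordered by reverse inclusion. -/
abbrev HypArrangement.IntersectionLattice {F V : Type*} [Field F] [AddCommGroup V] [Module F V]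
    (𝓗 : HypArrangement F V) : Type _ :=
  {W : Submodule F V // ∃ 𝓢 ⊆ 𝓗.hyps, W = sInf 𝓢}ᵒᵈ

theorem comap_subtype_eq_top_or_isCoatom {F V : Type*} [Field F] [AddCommGroup V] [Module F V]
    (S H : Submodule F V) (hH : IsCoatom H) :
    H.comap S.subtype = ⊤ ∨ IsCoatom (H.comap S.subtype) := by
  obtain ⟨f, rfl⟩ := exists_ker_eq H (Or.inr hH)
  rw [← LinearMap.ker_comp]
  by_cases h : f ∘ₗ S.subtype = 0
  · exact Or.inl (LinearMap.ker_eq_top.2 h)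
  · exact Or.inr (LinearMap.isCoatom_ker_of_surjective (LinearMap.surjective h))

/-- The arrangement `𝓗^S = {H ∩ S : H ∈ 𝓗, H ⊉ S}` induced in the subspace `S`. -/
def HypArrangement.induced {F V : Type*} [Field F] [AddCommGroup V] [Module F V]
    (𝓗 : HypArrangement F V) (S : Submodule F V) : HypArrangement F S where
  hyps := {K | ∃ H ∈ 𝓗.hyps, ¬ S ≤ H ∧ K = H.comap S.subtype}
  finite := (𝓗.finite.image fun H => H.comap S.subtype).subset (by
    rintro _ ⟨H, hH, -, rfl⟩; exact ⟨H, hH, rfl⟩)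
  isCoatom := by
    rintro _ ⟨H, hH, hS, rfl⟩
    refine (comap_subtype_eq_top_or_isCoatom S H (𝓗.isCoatom H hH)).resolve_left fun h => hS ?_
    exact Submodule.comap_subtype_eq_top.1 h

/-- The labelled arrangement `e ↦ H_e ∩ S` traced in `S` by a family of hyperplanes. -/
def LabArrangement.trace {F V ι : Type*} [Field F] [AddCommGroup V] [Module F V]
    (𝓚 : LabArrangement F V ι) (S : Submodule F V) : LabArrangement F S ι where
  hyp e := (𝓚.hyp e).comap S.subtype
  eq_top_or_isCoatom e := by
    rcases 𝓚.eq_top_or_isCoatom e with h | h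
    · left; rw [h, Submodule.comap_top]
    · exact comap_subtype_eq_top_or_isCoatom S _ h

/-- The coordinate hyperplane `H_e = {x : x_e = 0}` in `F^m`. -/
def coordHyp (F : Type*) [Field F] {m : ℕ} (e : Fin m) : Submodule F (Fin m → F) :=
  LinearMap.ker (LinearMap.proj e : (Fin m → F) →ₗ[F] F)

theorem isCoatom_coordHyp (F : Type*) [Field F] {m : ℕ} (e : Fin m) :
    IsCoatom (coordHyp F e) :=
  LinearMap.isCoatom_ker_of_surjective (LinearMap.proj_surjective e)

/-- The arrangement `𝓗_m` of coordinate hyperplanes in `F^m`. -/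
def coordArrangement (F : Type*) [Field F] (m : ℕ) : HypArrangement F (Fin m → F) where
  hyps := Set.range (coordHyp F)
  finite := Set.finite_range _
  isCoatom := by rintro _ ⟨e, rfl⟩; exact isCoatom_coordHyp F e

/-- The coordinate hyperplanes in `F^m`, labelled by `e ∈ [m]`. -/
def labCoordArrangement (F : Type*) [Field F] (m : ℕ) : LabArrangement F (Fin m → F) (Fin m) where
  hyp := coordHyp F
  eq_top_or_isCoatom e := Or.inr (isCoatom_coordHyp F e)

/-- The hyperplanes of the induced arrangement are those of the labelled one, without the
degenerate ones and without labels. -/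
theorem hyps_induced_coordArrangement (F : Type*) [Field F] (m : ℕ)
    (S : Submodule F (Fin m → F)) :
    ((coordArrangement F m).induced S).hyps
      = Set.range ((labCoordArrangement F m).trace S).hyp \ {⊤} := by
  ext K
  constructor
  · rintro ⟨_, ⟨e, rfl⟩, h, rfl⟩
    exact ⟨⟨e, rfl⟩, fun h' => h (Submodule.comap_subtype_eq_top.1 h')⟩
  · rintro ⟨⟨e, rfl⟩, h⟩
    exact ⟨_, ⟨e, rfl⟩, fun h' => h (Submodule.comap_subtype_eq_top.2 h'), rfl⟩

/-- For a subspace `W` of `S ⊆ F^m`, the set `{e ∈ [m] : H_e ⊇ W}`. -/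
def labelsContaining {F : Type*} [Field F] {m : ℕ} {S : Submodule F (Fin m → F)}
    (W : Submodule F S) : Set (Fin m) :=
  {e | W.map S.subtype ≤ coordHyp F e}

/-- The row space of a matrix. -/
def rowSpace {F : Type*} [Field F] {n m : ℕ} (A : Matrix (Fin n) (Fin m) F) :
    Submodule F (Fin m → F) :=
  Submodule.span F (Set.range A.row)

/-- The null space of a matrix. -/
def nullSpace {F : Type*} [Field F] {n m : ℕ} (A : Matrix (Fin n) (Fin m) F) :
    Submodule F (Fin m → F) :=
  LinearMap.ker A.mulVecLin

end Arrangements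

section ChainGroups

/-- `C` is a minimal nonempty support of a vector in `S`. -/
def IsMinSupport {F ι : Type*} [Field F] (S : Submodule F (ι → F)) (C : Set ι) : Prop :=
  Minimal (fun D : Set ι => D.Nonempty ∧ ∃ x ∈ S, Function.support x = D) C

theorem exists_minSupport_iff {F ι : Type*} [Field F] [Finite ι] (S : Submodule F (ι → F))
    (I : Set ι) :
    (∃ C ⊆ I, IsMinSupport S C) ↔ ∃ x ∈ S, x ≠ 0 ∧ Function.support x ⊆ I := by
  constructor
  · rintro ⟨C, hC, ⟨hne, x, hx, rfl⟩, -⟩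
    exact ⟨x, hx, Function.support_nonempty_iff.1 hne, hC⟩
  · rintro ⟨x, hx, hx0, hxI⟩
    obtain ⟨C, hC, hmin⟩ := (Set.toFinite
      {D : Set ι | D.Nonempty ∧ ∃ x ∈ S, Function.support x = D}).exists_le_minimal
      (a := Function.support x) ⟨Function.support_nonempty_iff.2 hx0, x, hx, rfl⟩
    exact ⟨C, le_trans hC hxI, hmin⟩

theorem exists_chainGroup_matroid {F ι : Type*} [Field F] [Finite ι] (S : Submodule F (ι → F)) :
    ∃ M : Matroid ι, univ = M.E ∧ ∀ I, M.Indep I ↔ ¬ ∃ C ⊆ I, IsMinSupport S C := by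
  classical
  have := Fintype.ofFinite ι
  refine ⟨linearMatroid F (fun e => S.mkQ (Pi.single e 1)) univ finite_univ, by simp, ?_⟩
  intro I
  rw [linearMatroid_indep_iff, exists_minSupport_iff]
  simp only [subset_univ, true_and]
  have := Fintype.ofFinite I
  rw [LinearIndepOn, Fintype.linearIndependent_iff]
  constructor
  · rintro h ⟨x, hx, hx0, hxI⟩
    apply hx0
    have hz := h (fun i => x i) (by
      simp only [← map_smul, ← map_sum]
      rw [Submodule.mkQ_apply, Submodule.Quotient.mk_eq_zero]
      convert hx using 1
      ext j
      simp only [Finset.sum_apply, Pi.smul_apply, Pi.single_apply, smul_eq_mul, mul_ite, mul_one,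
        mul_zero]
      by_cases hj : j ∈ I
      · rw [Finset.sum_eq_single (⟨j, hj⟩ : I)] <;> simp +contextual [Subtype.ext_iff, eq_comm]
      · rw [Finset.sum_eq_zero]
        · by_contra hne; exact hj (hxI (Ne.symm hne))
        · rintro ⟨i, hi⟩ -
          rw [if_neg]; rintro rfl; exact hj hi)
    ext j
    by_cases hj : j ∈ I
    · exact hz ⟨j, hj⟩
    · by_contra hne; exact hj (hxI hne)
  · intro h g hg i
    by_contra hgi
    apply h
    simp only [← map_smul, ← map_sum] at hg
    rw [Submodule.mkQ_apply, Submodule.Quotient.mk_eq_zero] at hg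
    refine ⟨_, hg, ?_, ?_⟩
    · intro h0
      apply hgi
      have := congrFun h0 i
      simp only [Finset.sum_apply, Pi.smul_apply, Pi.single_apply, smul_eq_mul, mul_ite, mul_one,
        mul_zero, Pi.zero_apply] at this
      rw [Finset.sum_eq_single i] at this
      · simpa using this
      · intro b _ hb; rw [if_neg]; intro h; exact hb (Subtype.ext h.symm)
      · simp
    · intro j hj
      by_contra hjI
      apply hj
      simp only [Finset.sum_apply, Pi.smul_apply, Pi.single_apply, smul_eq_mul, mul_ite, mul_one,
        mul_zero]
      apply Finset.sum_eq_zero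
      rintro ⟨i, hi⟩ -
      rw [if_neg]; rintro rfl; exact hjI hi

/-- The chain-group matroid `N(S)`: the matroid whose circuits are the minimal nonempty supports
of vectors in `S` (see `chainGroupMatroid_isCircuit_iff`). -/
noncomputable def chainGroupMatroid {F ι : Type*} [Field F] [Finite ι] (S : Submodule F (ι → F)) :
    Matroid ι :=
  Matroid.ofExistsMatroid univ (fun I => ¬ ∃ C ⊆ I, IsMinSupport S C) (exists_chainGroup_matroid S)

theorem chainGroupMatroid_isCircuit_iff {F ι : Type*} [Field F] [Finite ι]
    (S : Submodule F (ι → F)) (C : Set ι) :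
    (chainGroupMatroid S).IsCircuit C ↔ IsMinSupport S C := by
  have hdep : ∀ D, (chainGroupMatroid S).Dep D ↔ ∃ C ⊆ D, IsMinSupport S C := by
    intro D
    have h1 : (chainGroupMatroid S).Indep D ↔ ¬ ∃ C ⊆ D, IsMinSupport S C := Iff.rfl
    have h2 : D ⊆ (chainGroupMatroid S).E := subset_univ D
    rw [Matroid.Dep, h1, not_not, and_iff_left h2]
  rw [Matroid.IsCircuit]
  constructor
  · intro h
    obtain ⟨D, hDC, hD⟩ := (hdep C).1 h.prop
    rwa [h.eq_of_superset ((hdep D).2 ⟨D, Subset.rfl, hD⟩) hDC]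
  · intro h
    refine ⟨(hdep C).2 ⟨C, Subset.rfl, h⟩, fun D hD hDC => ?_⟩
    obtain ⟨B, hBD, hB⟩ := (hdep D).1 hD
    exact (h.2 hB.1 (hBD.trans hDC)).trans hBD

end ChainGroups

/-! ## Regions -/

section Regions

/-- The complement of the union of a set of subspaces. -/
def arrangementComplement {F V : Type*} [Field F] [AddCommGroup V] [Module F V]
    (𝓚 : Set (Submodule F V)) : Set V :=
  {x | ∀ K ∈ 𝓚, x ∉ K}

/-- The (open) regions over an ordered field: the polygonally connected components of the
complement of the union. Two points are in the same component if they are joined by a chain of line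
segments inside the complement. Over `ℝ` these are the connected components of the complement
(see `regions_real`). -/
def regions {F V : Type*} [Field F] [LinearOrder F] [AddCommGroup V] [Module F V]
    (𝓚 : Set (Submodule F V)) : Set (Set V) :=
  {R | ∃ x ∈ arrangementComplement 𝓚,
    R = {y | Relation.ReflTransGen (fun a b => segment F a b ⊆ arrangementComplement 𝓚) x y}}

theorem regions_real {V : Type*} [NormedAddCommGroup V] [NormedSpace ℝ V] [FiniteDimensional ℝ V]
    (𝓚 : Set (Submodule ℝ V)) (h𝓚 : 𝓚.Finite) :
    regions 𝓚 = {R | ∃ x ∈ arrangementComplement 𝓚,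
      R = connectedComponentIn (arrangementComplement 𝓚) x} := by
  set C := arrangementComplement 𝓚 with hC
  have hopen : IsOpen C := by
    have : C = (⋃ K ∈ 𝓚, (K : Set V))ᶜ := by
      ext x; simp [hC, arrangementComplement]
    rw [this, isOpen_compl_iff]
    exact h𝓚.isClosed_biUnion fun K _ => Submodule.closed_of_finiteDimensional K
  let r : V → V → Prop := fun a b => segment ℝ a b ⊆ C
  have hsymm : ∀ a b, r a b → r b a := fun a b h => by
    change segment ℝ b a ⊆ C; rw [segment_symm]; exact h
  have hsub : ∀ x ∈ C, ∀ y, Relation.ReflTransGen r x y → y ∈ connectedComponentIn C x := by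
    intro x hx y hy
    induction hy with
    | refl => exact mem_connectedComponentIn hx
    | @tail a b _ hab ih =>
      rw [connectedComponentIn_eq ih]
      exact ((convex_segment a b).isPreconnected.subset_connectedComponentIn
        (left_mem_segment ℝ a b) hab) (right_mem_segment ℝ a b)
  have hloc : ∀ y ∈ C, ∃ ε > 0, ∀ z ∈ Metric.ball y ε, r y z := by
    intro y hy
    obtain ⟨ε, hε, hb⟩ := Metric.isOpen_iff.1 hopen y hy
    exact ⟨ε, hε, fun z hz => ((convex_ball y ε).segment_subset
      (Metric.mem_ball_self hε) hz).trans hb⟩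
  have hmemC : ∀ x ∈ C, ∀ y, Relation.ReflTransGen r x y → y ∈ C := fun x hx y hy =>
    connectedComponentIn_subset _ _ (hsub x hx y hy)
  have hopenR : ∀ x ∈ C, IsOpen {y | Relation.ReflTransGen r x y} := by
    intro x hx
    rw [Metric.isOpen_iff]
    intro y hy
    obtain ⟨ε, hε, h⟩ := hloc y (hmemC x hx y hy)
    exact ⟨ε, hε, fun z hz => Relation.ReflTransGen.tail hy (h z hz)⟩
  have heq : ∀ x ∈ C, {y | Relation.ReflTransGen r x y} = connectedComponentIn C x := by
    intro x hx
    refine Subset.antisymm (hsub x hx) fun y hy => ?_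
    by_contra hny
    have hV : IsOpen (⋃ z ∈ C \ {y | Relation.ReflTransGen r x y},
        {y | Relation.ReflTransGen r z y}) :=
      isOpen_biUnion fun z hz => hopenR z hz.1
    obtain ⟨w, -, hw1, hw2⟩ := (isPreconnected_connectedComponentIn (F := C) (x := x)) _ _
      (hopenR x hx) hV
      (by
        intro z hz
        by_cases h : Relation.ReflTransGen r x z
        · exact Or.inl h
        · exact Or.inr (mem_biUnion (x := z) ⟨connectedComponentIn_subset _ _ hz, h⟩
            Relation.ReflTransGen.refl))
      ⟨x, mem_connectedComponentIn hx, Relation.ReflTransGen.refl⟩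
      ⟨y, hy, mem_biUnion (x := y) ⟨connectedComponentIn_subset _ _ hy, hny⟩
        Relation.ReflTransGen.refl⟩
    simp only [mem_iUnion] at hw2
    obtain ⟨z, hz, hzw⟩ := hw2
    have : Std.Symm r := ⟨hsymm⟩
    exact hz.2 (Relation.ReflTransGen.trans hw1
      ((Relation.ReflTransGen.stdSymm (r := r)).symm _ _ hzw))
  ext R
  constructor
  · rintro ⟨x, hx, rfl⟩; exact ⟨x, hx, heq x hx⟩
  · rintro ⟨x, hx, rfl⟩; exact ⟨x, hx, (heq x hx).symm⟩

end Regions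

/-! ## Oriented matroids -/

section OrientedMatroids

/-- An oriented matroid on `E`, given by its signed circuits; a signed subset of `E` is a function
`E → {-1, 0, 1}`. -/
structure OrientedMatroid (E : Type*) where
  circuits : Set (E → SignType)
  zero_notMem : (0 : E → SignType) ∉ circuits
  neg_mem : ∀ X ∈ circuits, -X ∈ circuits
  eq_or_eq_neg : ∀ X ∈ circuits, ∀ Y ∈ circuits,
    Function.support X ⊆ Function.support Y → X = Y ∨ X = -Y
  elimination : ∀ X ∈ circuits, ∀ Y ∈ circuits, X ≠ -Y → ∀ e, X e ≠ 0 → X e = -Y e →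
    ∃ Z ∈ circuits, Z e = 0 ∧ ∀ f, Z f = 0 ∨ Z f = X f ∨ Z f = Y f

namespace OrientedMatroid

open Classical in
/-- Reverse the signs of a signed set at the elements of `T`. -/
noncomputable def flip {E : Type*} (T : Set E) (X : E → SignType) : E → SignType :=
  fun e => if e ∈ T then -X e else X e

theorem flip_neg {E : Type*} (T : Set E) (X : E → SignType) : flip T (-X) = -flip T X := by
  ext e; by_cases h : e ∈ T <;> simp [flip, h]

theorem flip_flip {E : Type*} (T : Set E) (X : E → SignType) : flip T (flip T X) = X := by
  ext e; by_cases h : e ∈ T <;> simp [flip, h]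

theorem support_flip {E : Type*} (T : Set E) (X : E → SignType) :
    Function.support (flip T X) = Function.support X := by
  ext e; by_cases h : e ∈ T <;> simp [flip, h]

/-- The orientation (reorientation) of `M` obtained by reversing the elements of `T`. -/
def reorient {E : Type*} (M : OrientedMatroid E) (T : Set E) : OrientedMatroid E where
  circuits := flip T '' M.circuits
  zero_notMem := by
    rintro ⟨X, hX, h⟩
    have h0 : X = 0 := by
      rw [← Function.support_eq_empty_iff, ← support_flip T, h, Function.support_zero]
    exact M.zero_notMem (h0 ▸ hX)
  neg_mem := by
    rintro _ ⟨X, hX, rfl⟩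
    exact ⟨-X, M.neg_mem X hX, flip_neg T X⟩
  eq_or_eq_neg := by
    rintro _ ⟨X, hX, rfl⟩ _ ⟨Y, hY, rfl⟩ h
    rw [support_flip, support_flip] at h
    rcases M.eq_or_eq_neg X hX Y hY h with rfl | rfl
    · exact Or.inl rfl
    · exact Or.inr (flip_neg T Y)
  elimination := by
    rintro _ ⟨X, hX, rfl⟩ _ ⟨Y, hY, rfl⟩ hne e he hXY
    obtain ⟨Z, hZ, hZe, hZf⟩ := M.elimination X hX Y hY
      (by rintro rfl; exact hne (flip_neg T Y)) e
      (by by_cases h : e ∈ T <;> simpa [flip, h] using he)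
      (by by_cases h : e ∈ T <;> simpa [flip, h, neg_eq_iff_eq_neg] using hXY)
    refine ⟨flip T Z, ⟨Z, hZ, rfl⟩, ?_, fun f => ?_⟩
    · by_cases h : e ∈ T <;> simp [flip, h, hZe]
    · by_cases h : f ∈ T <;> simpa [flip, h] using hZf f

/-- An oriented matroid is acyclic if it has no positive circuit. -/
def IsAcyclic {E : Type*} (M : OrientedMatroid E) : Prop :=
  ¬ ∃ X ∈ M.circuits, ∀ e, 0 ≤ X e

/-- An oriented matroid is totally cyclic if every element is in a positive circuit. -/
def IsTotallyCyclic {E : Type*} (M : OrientedMatroid E) : Prop :=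
  ∀ e, ∃ X ∈ M.circuits, (∀ f, 0 ≤ X f) ∧ X e ≠ 0

end OrientedMatroid

/-- `x` is a nonzero vector of `W` with minimal support. -/
def IsElementary {F E : Type*} [Field F] (W : Submodule F (E → F)) (x : E → F) : Prop :=
  x ∈ W ∧ x ≠ 0 ∧ ∀ y ∈ W, y ≠ 0 → Function.support y ⊆ Function.support x →
    Function.support x ⊆ Function.support y

theorem exists_conformal_elementary {F E : Type*} [Field F] [LinearOrder F]
    [IsStrictOrderedRing F] [Finite E] (W : Submodule F (E → F)) :
    ∀ (k : ℕ) (z : E → F), (Function.support z).ncard = k → z ∈ W → z ≠ 0 →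
      ∃ w, IsElementary W w ∧
        ∀ f, SignType.sign (w f) = 0 ∨ SignType.sign (w f) = SignType.sign (z f) := by
  classical
  have := Fintype.ofFinite E
  intro k
  induction k using Nat.strong_induction_on with
  | _ k ih =>
    intro z hk hz hz0
    by_cases hel : IsElementary W z
    · exact ⟨z, hel, fun f => Or.inr rfl⟩
    have hel' : ∃ y ∈ W, y ≠ 0 ∧ Function.support y ⊆ Function.support z ∧
        ¬ Function.support z ⊆ Function.support y := by
      by_contra hcon
      push Not at hcon
      exact hel ⟨hz, hz0, hcon⟩
    have hel2 : ∃ y ∈ W, (∃ f, 0 < y f * z f) ∧ Function.support y ⊆ Function.support z ∧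
        ¬ Function.support z ⊆ Function.support y := by
      obtain ⟨y, hy, hy0, hyz, hzy⟩ := hel'
      obtain ⟨f, hf⟩ := Function.ne_iff.1 hy0
      have hzf : z f ≠ 0 := hyz hf
      rcases lt_or_gt_of_ne (mul_ne_zero hf hzf) with h | h
      · refine ⟨-y, W.neg_mem hy, ⟨f, by simpa using h⟩, ?_, ?_⟩
        · rwa [Function.support_neg]
        · rwa [Function.support_neg]
      · exact ⟨y, hy, ⟨f, h⟩, hyz, hzy⟩
    obtain ⟨y, hy, ⟨f1, hf1⟩, hyz, hzy⟩ := hel2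
    obtain ⟨f0, hf0, hmin⟩ := Finset.exists_min_image
      (Finset.univ.filter fun f => 0 < y f * z f) (fun f => z f / y f) ⟨f1, by simpa using hf1⟩
    simp only [Finset.mem_filter, Finset.mem_univ, true_and] at hf0 hmin
    have hyf0 : y f0 ≠ 0 := fun h => by simp [h] at hf0
    set t := z f0 / y f0 with ht
    have htpos : 0 < t := by
      rw [ht, div_eq_mul_inv]
      rcases lt_or_gt_of_ne hyf0 with h | h
      · exact mul_pos_of_neg_of_neg (by nlinarith) (inv_lt_zero.2 h)
      · exact mul_pos (by nlinarith) (inv_pos.2 h)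
    let z' : E → F := z - t • y
    have hz'W : z' ∈ W := W.sub_mem hz (W.smul_mem t hy)
    have hz'f : ∀ f, z' f = z f - t * y f := fun f => rfl
    have hconf : ∀ f, SignType.sign (z' f) = 0 ∨ SignType.sign (z' f) = SignType.sign (z f) := by
      intro f
      rw [hz'f]
      rcases lt_trichotomy (y f) 0 with h | h | h
      · rcases lt_trichotomy (z f) 0 with h2 | h2 | h2
        · have h3 := hmin f (mul_pos_of_neg_of_neg h h2)
          rw [le_div_iff_of_neg h] at h3
          rcases h3.lt_or_eq with h4 | h4
          · right; rw [sign_neg h2, sign_neg (by linarith)]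
          · left; rw [h4]; simp
        · exact absurd h2 (hyz h.ne)
        · right; rw [sign_pos h2, sign_pos (by nlinarith)]
      · right; rw [h]; simp
      · rcases lt_trichotomy (z f) 0 with h2 | h2 | h2
        · right; rw [sign_neg h2, sign_neg (by nlinarith)]
        · exact absurd h2 (hyz h.ne')
        · have h3 := hmin f (mul_pos h h2)
          rw [le_div_iff₀ h] at h3
          rcases h3.lt_or_eq with h4 | h4
          · right; rw [sign_pos h2, sign_pos (by linarith)]
          · left; rw [h4]; simp
    have hz'0 : z' ≠ 0 := by
      obtain ⟨g, hg, hgy⟩ := Set.not_subset.1 hzy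
      intro h
      have h1 := congrFun h g
      rw [hz'f, Function.notMem_support.1 hgy] at h1
      exact hg (by simpa using h1)
    have hlt : (Function.support z').ncard < k := by
      rw [← hk]
      refine Set.ncard_lt_ncard ⟨?_, ?_⟩ (Set.toFinite _)
      · intro f hf
        rcases hconf f with h | h
        · exact absurd (sign_eq_zero_iff.1 h) hf
        · intro h0
          rw [h0, sign_zero] at h
          exact hf (sign_eq_zero_iff.1 h)
      · intro h
        have h1 : f0 ∈ Function.support z := hyz hyf0
        apply h h1
        rw [hz'f, ht]; field_simp; ring
    obtain ⟨w, hw, hwf⟩ := ih _ hlt z' rfl hz'W hz'0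
    refine ⟨w, hw, fun f => ?_⟩
    rcases hwf f with h | h
    · exact Or.inl h
    · rcases hconf f with h2 | h2
      · exact Or.inl (h.trans h2)
      · exact Or.inr (h.trans h2)

theorem IsElementary.eq_smul {F E : Type*} [Field F] {W : Submodule F (E → F)} {x y : E → F}
    (hx : IsElementary W x) (hy : IsElementary W y)
    (h : Function.support x ⊆ Function.support y) : ∃ c : F, c ≠ 0 ∧ x = c • y := by
  obtain ⟨f, hf⟩ := Function.ne_iff.1 hx.2.1
  have hyf : y f ≠ 0 := h hf
  refine ⟨x f / y f, div_ne_zero hf hyf, ?_⟩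
  by_contra hne
  have h1 := hy.2.2 (x - (x f / y f) • y) (W.sub_mem hx.1 (W.smul_mem _ hy.1)) (sub_ne_zero.2 hne)
    (by
      intro g hg hyg
      have hxg : x g = 0 := by
        by_contra hxg; exact h hxg hyg
      exact hg (by simp [hyg, hxg]))
  exact h1 hyf (by simp [hyf])

/-- The oriented matroid whose signed circuits are the sign patterns of the nonzero vectors of
minimal support in the subspace `W`. -/
def OrientedMatroid.ofSubspace {F E : Type*} [Field F] [LinearOrder F] [IsStrictOrderedRing F]
    [Finite E] (W : Submodule F (E → F)) : OrientedMatroid E where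
  circuits := {X | ∃ x, IsElementary W x ∧ X = fun e => SignType.sign (x e)}
  zero_notMem := by
    rintro ⟨x, hx, h⟩
    apply hx.2.1
    ext e
    exact sign_eq_zero_iff.1 (congrFun h e).symm
  neg_mem := by
    rintro _ ⟨x, hx, rfl⟩
    refine ⟨-x, ⟨W.neg_mem hx.1, neg_ne_zero.2 hx.2.1, ?_⟩, ?_⟩
    · simpa using hx.2.2
    · ext e; simp [Left.sign_neg]
  eq_or_eq_neg := by
    rintro _ ⟨x, hx, rfl⟩ _ ⟨y, hy, rfl⟩ h
    obtain ⟨c, hc, rfl⟩ := hx.eq_smul hy (by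
      intro e he
      have := @h e (by simpa [sign_eq_zero_iff] using he)
      simpa [sign_eq_zero_iff] using this)
    rcases lt_or_gt_of_ne hc with h | h
    · right; ext e; simp [sign_mul, sign_neg h]
    · left; ext e; simp [sign_mul, sign_pos h]
  elimination := by
    rintro _ ⟨x, hx, rfl⟩ _ ⟨y, hy, rfl⟩ hne e he hxy
    beta_reduce at hxy
    change SignType.sign (x e) = -SignType.sign (y e) at hxy
    have hxe : x e ≠ 0 := by simpa [sign_eq_zero_iff] using he
    have hye : y e ≠ 0 := by
      intro h; rw [h] at hxy; simp [sign_eq_zero_iff, hxe] at hxy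
    have hz0 : |y e| • x + |x e| • y ≠ 0 := by
      intro h0
      apply hne
      ext f
      have h1 := congrFun h0 f
      simp only [Pi.add_apply, Pi.smul_apply, smul_eq_mul, Pi.zero_apply] at h1
      have h2 : |y e| * x f = |x e| * (-y f) := by linarith
      have h3 := congrArg SignType.sign h2
      rw [sign_mul, sign_mul, sign_pos (abs_pos.2 hxe), sign_pos (abs_pos.2 hye), one_mul,
        one_mul, Left.sign_neg] at h3
      exact h3
    obtain ⟨w, hw, hwf⟩ := exists_conformal_elementary W _ (|y e| • x + |x e| • y) rfl
      (W.add_mem (W.smul_mem _ hx.1) (W.smul_mem _ hy.1)) hz0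
    refine ⟨_, ⟨w, hw, rfl⟩, ?_, fun f => ?_⟩
    · have h0 : (|y e| • x + |x e| • y) e = 0 := by
        simp only [Pi.add_apply, Pi.smul_apply, smul_eq_mul]
        rcases lt_or_gt_of_ne hxe with h | h <;> rcases lt_or_gt_of_ne hye with h' | h'
        · simp [sign_neg h, sign_neg h'] at hxy
        · rw [abs_of_neg h, abs_of_pos h']; ring
        · rw [abs_of_pos h, abs_of_neg h']; ring
        · simp [sign_pos h, sign_pos h'] at hxy
      have := hwf e
      rw [h0] at this
      simpa using this
    · rcases hwf f with h | h
      · exact Or.inl h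
      · simp only [Pi.add_apply, Pi.smul_apply, smul_eq_mul] at h
        have ha := abs_pos.2 hxe
        have hb := abs_pos.2 hye
        beta_reduce
        rw [h]
        rcases lt_trichotomy (x f) 0 with h1 | h1 | h1 <;>
          rcases lt_trichotomy (y f) 0 with h2 | h2 | h2
        · right; left; rw [sign_neg h1, sign_neg (by nlinarith)]
        · right; left; rw [sign_neg h1, sign_neg (by rw [h2]; nlinarith)]
        · rw [sign_neg h1, sign_pos h2]
          generalize SignType.sign (|y e| * x f + |x e| * y f) = s
          revert s; decide
        · right; right; rw [sign_neg h2, sign_neg (by rw [h1]; nlinarith)]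
        · left; rw [h1, h2]; simp
        · right; right; rw [sign_pos h2, sign_pos (by rw [h1]; nlinarith)]
        · rw [sign_pos h1, sign_neg h2]
          generalize SignType.sign (|y e| * x f + |x e| * y f) = s
          revert s; decide
        · right; left; rw [sign_pos h1, sign_pos (by rw [h2]; nlinarith)]
        · right; left; rw [sign_pos h1, sign_pos (by nlinarith)]

/-- The oriented matroid of columns of `A`: its signed circuits are the sign patterns of the minimal
linear dependencies among the columns. -/
def columnOrientedMatroid {F : Type*} [Field F] [LinearOrder F] [IsStrictOrderedRing F] {n m : ℕ}
    (A : Matrix (Fin n) (Fin m) F) : OrientedMatroid (Fin m) :=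
  OrientedMatroid.ofSubspace (nullSpace A)

/-- The regions of `𝓚`, a set of subspaces of `S ⊆ F^m`, correspond bijectively to the orientations
of `M` that satisfy `P`, where an orientation of `M` is a choice of one of the two directions of
every element, encoded by the set `T` of reversed elements, and where `T` consists of the coordinates
that are negative on the region. -/
def RegionsCorrespond {F : Type*} [Field F] [LinearOrder F] {m : ℕ} {S : Submodule F (Fin m → F)}
    (𝓚 : Set (Submodule F S)) (M : OrientedMatroid (Fin m))
    (P : OrientedMatroid (Fin m) → Prop) : Prop :=
  ∃ φ : regions 𝓚 ≃ {T : Set (Fin m) // P (M.reorient T)},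
    ∀ R : regions 𝓚, ∀ x ∈ R.1, ∀ e, e ∈ (φ R).1 ↔ (x : Fin m → F) e < 0

end OrientedMatroids

/-! Write `S⊥` for the orthogonal space under the dot product, so that `U⊥ = Z` and `Z⊥ = U`. A
linear relation `∑ c_e x_e = 0` among the coordinate functionals restricted to `S` says exactly that
`c ∈ S⊥`, so the labelled arrangement traced in `S` has matroid `N(S⊥)`
(`matroid_trace_labCoordArrangement`). A linear relation among the columns of `A` is a vector of
`Z`, so `M(A) = N(Z)`. This settles both isomorphisms in (a). The duality holds because `B` is a
base of `N(S)` iff `F^m = S ⊕ F^B` (`chainGroupMatroid_isBase_iff`), and orthogonality turns this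
splitting into `F^m = S⊥ ⊕ F^(Bᶜ)`.

Part (b) holds for any labelled arrangement: `e` is in the closure of `X` iff the hyperplane of `e`
contains the intersection over `X` (`LabArrangement.mem_closure_matroid_iff`), so flats and
intersections determine each other.

For (c), the regions in `S` are the sign patterns of the nowhere zero vectors of `S`: a segment
between equal patterns avoids every coordinate hyperplane, and one between different patterns meets
some hyperplane. It remains to see which `T` are negative sets of such vectors. Reversing `T` is
acyclic iff `Z⊥ = U` has a vector that is positive after the reversal; this is Gordan's theorem,
together with the fact that a nonnegative vector of `Z` yields a positive circuit. Reversing `T` is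
totally cyclic iff `Z` itself has such a vector: add positive circuits in one direction, extract
them from a positive vector in the other. -/

/-! ### Orthogonal complements for the dot product. -/

section OrthogonalSpace

/-- The orthogonal complement of a subspace of `F^ι` for the dot product. -/
def orthSpace {F ι : Type*} [Field F] [Fintype ι] (S : Submodule F (ι → F)) :
    Submodule F (ι → F) where
  carrier := {c | ∀ x ∈ S, c ⬝ᵥ x = 0}
  zero_mem' := fun x _ => zero_dotProduct x
  add_mem' := fun {a b} ha hb x hx => by rw [add_dotProduct, ha x hx, hb x hx, add_zero]
  smul_mem' := fun a c hc x hx => by rw [smul_dotProduct, hc x hx, smul_zero]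

theorem mem_orthSpace {F ι : Type*} [Field F] [Fintype ι] {S : Submodule F (ι → F)} {c : ι → F} :
    c ∈ orthSpace S ↔ ∀ x ∈ S, c ⬝ᵥ x = 0 := Iff.rfl

theorem dual_apply_eq_dotProduct {F ι : Type*} [Field F] [Fintype ι] [DecidableEq ι]
    (f : Module.Dual F (ι → F)) (x : ι → F) : f x = (fun i => f (Pi.single i 1)) ⬝ᵥ x := by
  conv_lhs => rw [pi_eq_sum_univ' x]
  simp only [dotProduct, map_sum, map_smul, smul_eq_mul, mul_comm]

/-- A point outside `S` is separated from `S` by a functional, and every functional on `F^ι` is the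
dot product with a vector, which here lies in `S⊥`. -/
theorem orthSpace_orthSpace {F ι : Type*} [Field F] [Fintype ι] (S : Submodule F (ι → F)) :
    orthSpace (orthSpace S) = S := by
  classical
  apply le_antisymm
  · intro x hx
    by_contra hxS
    obtain ⟨f, hf, hS⟩ := Submodule.exists_le_ker_of_notMem hxS
    apply hf
    rw [dual_apply_eq_dotProduct, dotProduct_comm]
    refine hx _ fun y hy => ?_
    rw [← dual_apply_eq_dotProduct]
    exact hS hy
  · intro x hx c hc
    rw [dotProduct_comm]
    exact hc x hx

theorem orthSpace_anti {F ι : Type*} [Field F] [Fintype ι] {S T : Submodule F (ι → F)}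
    (h : S ≤ T) : orthSpace T ≤ orthSpace S :=
  fun _ hc x hx => hc x (h hx)

theorem orthSpace_top {F ι : Type*} [Field F] [Fintype ι] :
    orthSpace (⊤ : Submodule F (ι → F)) = ⊥ := by
  classical
  rw [eq_bot_iff]
  intro c hc
  ext i
  simpa using hc (Pi.single i 1) trivial

theorem orthSpace_sup {F ι : Type*} [Field F] [Fintype ι] (S T : Submodule F (ι → F)) :
    orthSpace (S ⊔ T) = orthSpace S ⊓ orthSpace T := by
  apply le_antisymm (le_inf (orthSpace_anti le_sup_left) (orthSpace_anti le_sup_right))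
  rintro c ⟨hS, hT⟩ x hx
  obtain ⟨y, hy, z, hz, rfl⟩ := Submodule.mem_sup.1 hx
  rw [dotProduct_add, hS y hy, hT z hz, add_zero]

theorem orthSpace_injective {F ι : Type*} [Field F] [Fintype ι] :
    Function.Injective (orthSpace : Submodule F (ι → F) → Submodule F (ι → F)) :=
  Function.LeftInverse.injective orthSpace_orthSpace

theorem IsCompl.orthSpace {F ι : Type*} [Field F] [Fintype ι] {S T : Submodule F (ι → F)}
    (h : IsCompl S T) : IsCompl (orthSpace S) (orthSpace T) := by
  refine ⟨?_, ?_⟩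
  · rw [disjoint_iff, ← orthSpace_sup, h.sup_eq_top, orthSpace_top]
  · rw [codisjoint_iff]
    -- Taking orthogonals once more turns the sum into the intersection of `S` and `T`, which is
    -- zero.
    apply orthSpace_injective
    rw [orthSpace_sup, orthSpace_orthSpace, orthSpace_orthSpace, h.inf_eq_bot, orthSpace_top]

theorem orthSpace_rowSpace {F : Type*} [Field F] {n m : ℕ} (A : Matrix (Fin n) (Fin m) F) :
    orthSpace (rowSpace A) = nullSpace A := by
  ext c
  rw [nullSpace, LinearMap.mem_ker, Matrix.mulVecLin_apply, mem_orthSpace]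
  constructor
  · intro h
    ext i
    rw [Matrix.mulVec, dotProduct_comm]
    exact h _ (Submodule.subset_span ⟨i, rfl⟩)
  · intro h x hx
    induction hx using Submodule.span_induction with
    | mem x hx =>
      obtain ⟨i, rfl⟩ := hx
      rw [dotProduct_comm]
      exact congrFun h i
    | zero => exact dotProduct_zero c
    | add x y _ _ hx hy => rw [dotProduct_add, hx, hy, add_zero]
    | smul a x _ hx => rw [dotProduct_smul, hx, smul_zero]

theorem orthSpace_nullSpace {F : Type*} [Field F] {n m : ℕ} (A : Matrix (Fin n) (Fin m) F) :
    orthSpace (nullSpace A) = rowSpace A := by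
  rw [← orthSpace_rowSpace, orthSpace_orthSpace]

end OrthogonalSpace

/-! ### Bases and duals of chain-group matroids. -/

section ChainGroupDuality

/-- Minimality of supports drops out, since on a finite set every nonempty support contains a
minimal one. -/
theorem chainGroupMatroid_indep_iff {F ι : Type*} [Field F] [Finite ι] (S : Submodule F (ι → F))
    (I : Set ι) :
    (chainGroupMatroid S).Indep I ↔ ∀ x ∈ S, Function.support x ⊆ I → x = 0 := by
  have h : (chainGroupMatroid S).Indep I ↔ ¬ ∃ C ⊆ I, IsMinSupport S C := Iff.rfl
  rw [h, exists_minSupport_iff]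
  push Not
  exact forall₂_congr fun x _ => by tauto

/-- This puts linear independence in the shape of `chainGroupMatroid_indep_iff`, the relations among
the `v i` playing the role of the subspace. -/
theorem linearIndepOn_iff_forall_support {F ι W : Type*} [Field F] [Fintype ι] [AddCommGroup W]
    [Module F W] (v : ι → W) (I : Set ι) :
    LinearIndepOn F v I ↔
      ∀ c : ι → F, ∑ i, c i • v i = 0 → Function.support c ⊆ I → c = 0 := by
  rw [linearIndepOn_iff, (Finsupp.equivFunOnFinite (α := ι) (M := F)).forall_congr_left]
  refine forall_congr' fun c => ?_
  have h1 : Finsupp.linearCombination F v (Finsupp.equivFunOnFinite.symm c) = ∑ i, c i • v i := by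
    rw [Finsupp.linearCombination_apply, Finsupp.sum_fintype _ _ fun i => zero_smul F (v i)]
    rfl
  have h2 : Finsupp.equivFunOnFinite.symm c = 0 ↔ c = 0 := by
    rw [Equiv.symm_apply_eq]
    rfl
  rw [Finsupp.mem_supported, ← Finsupp.fun_support_eq,
    Finsupp.coe_equivFunOnFinite_symm, h1, h2]
  tauto

/-- The vectors of `F^ι` that vanish outside `B`. -/
def supportedIn (F : Type*) {ι : Type*} [Field F] (B : Set ι) : Submodule F (ι → F) where
  carrier := {x | ∀ i ∉ B, x i = 0}
  zero_mem' := fun _ _ => rfl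
  add_mem' := fun {a b} ha hb i hi => by simp [ha i hi, hb i hi]
  smul_mem' := fun a c hc i hi => by simp [hc i hi]

theorem mem_supportedIn {F ι : Type*} [Field F] {B : Set ι} {x : ι → F} :
    x ∈ supportedIn F B ↔ Function.support x ⊆ B := by
  rw [Function.support_subset_iff']
  rfl

theorem orthSpace_supportedIn {F ι : Type*} [Field F] [Fintype ι] (B : Set ι) :
    orthSpace (supportedIn F B) = supportedIn F Bᶜ := by
  classical
  ext c
  constructor
  · intro h i hi
    rw [notMem_compl_iff] at hi
    simpa using h (Pi.single i 1) fun j hj => Pi.single_eq_of_ne (by rintro rfl; exact hj hi) _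
  · intro h x hx
    refine Finset.sum_eq_zero fun i _ => ?_
    by_cases hi : i ∈ B
    · rw [h i (not_not.2 hi), zero_mul]
    · rw [hx i hi, mul_zero]

/-- Independence of `B` is the trivial intersection of `S` with `F^B`; maximality of `B` is that the
two span, which is tested on unit vectors. -/
theorem chainGroupMatroid_isBase_iff {F ι : Type*} [Field F] [Fintype ι]
    (S : Submodule F (ι → F)) (B : Set ι) :
    (chainGroupMatroid S).IsBase B ↔ IsCompl S (supportedIn F B) := by
  classical
  have hind : ∀ I, (chainGroupMatroid S).Indep I ↔ Disjoint S (supportedIn F I) := by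
    intro I
    rw [chainGroupMatroid_indep_iff, Submodule.disjoint_def]
    exact forall₂_congr fun x _ => by rw [mem_supportedIn]
  rw [Matroid.isBase_iff_maximal_indep]
  constructor
  · intro h
    refine ⟨(hind B).1 h.prop, ?_⟩
    rw [codisjoint_iff, eq_top_iff]
    have hsing : ∀ e, Pi.single e (1 : F) ∈ S ⊔ supportedIn F B := by
      intro e
      by_cases he : e ∈ B
      · refine Submodule.mem_sup_right fun j hj => Pi.single_eq_of_ne ?_ _
        rintro rfl; exact hj he
      · have hdep : ¬ (chainGroupMatroid S).Indep (insert e B) :=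
          fun hi => he (h.le_of_ge hi (subset_insert e B) (mem_insert e B))
        rw [chainGroupMatroid_indep_iff] at hdep
        push Not at hdep
        obtain ⟨x, hx, hxs, hx0⟩ := hdep
        have hxe : x e ≠ 0 := by
          intro hxe
          refine hx0 ((chainGroupMatroid_indep_iff S B).1 h.prop x hx fun j hj => ?_)
          refine (hxs hj).resolve_left ?_
          rintro rfl; exact hj hxe
        -- The vector `x ∈ S` is supported in `B ∪ {e}`. Scaled to have coordinate 1 at `e`, it
        -- differs from the unit vector by something supported in `B`.
        have : Pi.single e (1 : F) = (x e)⁻¹ • x + (Pi.single e 1 - (x e)⁻¹ • x) := by abel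
        rw [this]
        refine Submodule.add_mem_sup (S.smul_mem _ hx) fun j hj => ?_
        by_cases hje : j = e
        · subst hje; simp [hxe]
        · have : x j = 0 := by
            by_contra hxj
            exact (hxs hxj).elim hje hj
          simp [this, hje]
    intro x _
    rw [pi_eq_sum_univ' x]
    exact Submodule.sum_mem _ fun e _ => Submodule.smul_mem _ _ (by
      convert hsing e using 1)
  · intro h
    refine ⟨(hind B).2 h.disjoint, fun J hJ hBJ e he => ?_⟩
    by_contra heB
    have hmem : Pi.single e (1 : F) ∈ S ⊔ supportedIn F B := by
      rw [h.sup_eq_top]; trivial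
    obtain ⟨s, hs, b, hb, hsb⟩ := Submodule.mem_sup.1 hmem
    -- Since `s` is the unit vector at `e` minus `b`, it is supported in the independent set `J`.
    -- Then the unit vector equals `b`, which vanishes at `e`.
    have hs0 : s = 0 := by
      refine (chainGroupMatroid_indep_iff S J).1 hJ s hs fun j hj => ?_
      by_contra hjJ
      have h1 := congrFun hsb j
      rw [Pi.add_apply, hb j (fun hjB => hjJ (hBJ hjB)), add_zero,
        Pi.single_eq_of_ne (by rintro rfl; exact hjJ he)] at h1
      exact hj h1
    have h2 := congrFun hsb e
    rw [Pi.add_apply, hb e heB, hs0] at h2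
    simp at h2

theorem chainGroupMatroid_orthSpace {F ι : Type*} [Field F] [Fintype ι]
    (S : Submodule F (ι → F)) :
    chainGroupMatroid (orthSpace S) = (chainGroupMatroid S).dual := by
  refine Matroid.ext_isBase rfl fun B _ => ?_
  have hE : (chainGroupMatroid S).E \ B = Bᶜ := (compl_eq_univ_sdiff B).symm
  rw [Matroid.dual_isBase_iff (subset_univ B), hE, chainGroupMatroid_isBase_iff,
    chainGroupMatroid_isBase_iff]
  constructor
  · intro h
    simpa only [orthSpace_orthSpace, orthSpace_supportedIn] using h.orthSpace
  · intro h
    simpa only [orthSpace_supportedIn, compl_compl] using h.orthSpace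

/-- The combination of the columns with coefficients `c` is `A c`, so the relations among the
columns are the null vectors. -/
theorem columnMatroid_eq_chainGroupMatroid {F : Type*} [Field F] {n m : ℕ}
    (A : Matrix (Fin n) (Fin m) F) : columnMatroid A = chainGroupMatroid (nullSpace A) := by
  refine Matroid.ext_indep (linearMatroid_ground _ _ _) fun I _ => ?_
  rw [columnMatroid, linearMatroid_indep_iff, chainGroupMatroid_indep_iff,
    linearIndepOn_iff_forall_support, and_iff_right (subset_univ I)]
  refine forall_congr' fun c => ?_
  have : ∑ i, c i • A.col i = A.mulVecLin c := by
    ext j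
    simp [Matrix.mulVec, dotProduct, mul_comm]
  rw [this]
  rfl

end ChainGroupDuality

/-! ### Matroids and intersection lattices of traced arrangements. -/

section ArrangementMatroids

theorem LabArrangement.matroid_ground {F V ι : Type*} [Field F] [AddCommGroup V] [Module F V]
    [FiniteDimensional F V] [Finite ι] (𝓚 : LabArrangement F V ι) : 𝓚.matroid.E = univ := rfl

theorem LabArrangement.matroid_indep_iff {F V ι : Type*} [Field F] [AddCommGroup V] [Module F V]
    [FiniteDimensional F V] [Finite ι] (𝓚 : LabArrangement F V ι) (I : Set ι) :
    𝓚.matroid.Indep I ↔ codim (⨅ e ∈ I, 𝓚.hyp e) = I.ncard := Iff.rfl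

theorem HypArrangement.matroid_indep_iff {F V : Type*} [Field F] [AddCommGroup V] [Module F V]
    [FiniteDimensional F V] (𝓗 : HypArrangement F V) (I : Set (Submodule F V)) :
    𝓗.matroid.Indep I ↔ I ⊆ 𝓗.hyps ∧ codim (⨅ H ∈ I, H) = I.ncard := Iff.rfl

/-- The codimension of an intersection of kernels is the rank of the functionals, so this is the
linear matroid of the coordinate functionals on `S`, whose relations form `S⊥`. -/
theorem matroid_trace_labCoordArrangement {F : Type*} [Field F] {m : ℕ}
    (S : Submodule F (Fin m → F)) :
    ((labCoordArrangement F m).trace S).matroid = chainGroupMatroid (orthSpace S) := by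
  refine Matroid.ext_indep rfl fun I _ => ?_
  have hker : ∀ e, ((labCoordArrangement F m).trace S).hyp e =
      LinearMap.ker ((LinearMap.proj e : (Fin m → F) →ₗ[F] F) ∘ₗ S.subtype) :=
    fun e => (LinearMap.ker_comp _ _).symm
  rw [LabArrangement.matroid_indep_iff]
  simp only [hker]
  rw [codim_iInf_ker, finrank_span_image_eq_ncard_iff _ I.toFinite,
    linearIndepOn_iff_forall_support, chainGroupMatroid_indep_iff]
  refine forall_congr' fun c => imp_congr_left ?_
  rw [mem_orthSpace, LinearMap.ext_iff, Subtype.forall]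
  refine forall₂_congr fun x hx => ?_
  simp [dotProduct]

/-- Independence in the pulled-back matroid means injectivity on `I` and independence of the image.
If the intersection over `I` has codimension `|I|`, then at least `|I|` distinct proper hyperplanes
occur, which leaves no room for repetitions or degenerate members. -/
theorem LabArrangement.matroid_eq_comapOn {F V ι : Type*} [Field F] [AddCommGroup V] [Module F V]
    [FiniteDimensional F V] [Finite ι] (𝓚 : LabArrangement F V ι) (𝓗 : HypArrangement F V)
    (h : 𝓗.hyps = Set.range 𝓚.hyp \ {⊤}) :
    𝓚.matroid = 𝓗.matroid.comapOn univ 𝓚.hyp := by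
  refine Matroid.ext_indep rfl fun I _ => ?_
  rw [Matroid.comapOn_indep_iff, HypArrangement.matroid_indep_iff, LabArrangement.matroid_indep_iff,
    iInf_image, and_iff_left (subset_univ I)]
  constructor
  · intro hI
    -- The whole space does not affect the intersection, but it must be removed before the rank in
    -- `𝓗` can be used.
    have hinf : (⨅ e ∈ I, 𝓚.hyp e) = sInf (𝓚.hyp '' I \ {⊤}) := by
      rw [sInf_sdiff_singleton_top, sInf_image]
    have h1 : 𝓚.hyp '' I \ {⊤} ⊆ 𝓗.hyps := by
      rw [h]; exact sdiff_subset_sdiff_left (image_subset_range _ _)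
    have h2 : I.ncard ≤ (𝓚.hyp '' I \ {⊤}).ncard := by
      have h3 := 𝓗.matroid.eRk_le_encard (𝓚.hyp '' I \ {⊤})
      rw [𝓗.eRk_matroid _ h1, ← hinf, hI, ← (toFinite (𝓚.hyp '' I \ {⊤})).cast_ncard_eq] at h3
      exact_mod_cast h3
    have h4 : (𝓚.hyp '' I).ncard ≤ I.ncard := ncard_image_le I.toFinite
    have h5 : 𝓚.hyp '' I \ {⊤} = 𝓚.hyp '' I :=
      eq_of_subset_of_ncard_le sdiff_subset (h4.trans h2) (toFinite _)
    rw [h5] at h1 h2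
    exact ⟨⟨h1, hI.trans (le_antisymm h2 h4)⟩, injOn_of_ncard_image_eq (le_antisymm h4 h2)⟩
  · rintro ⟨⟨-, hI⟩, hinj⟩
    rw [hI, hinj.ncard_image]

theorem codim_inj_of_le {F V : Type*} [Field F] [AddCommGroup V] [Module F V]
    [FiniteDimensional F V] {W₁ W₂ : Submodule F V} (hle : W₁ ≤ W₂) (h : codim W₁ = codim W₂) :
    W₁ = W₂ := by
  have h1 := Submodule.finrank_quotient_add_finrank W₁
  have h2 := Submodule.finrank_quotient_add_finrank W₂
  rw [codim, codim] at h
  exact Submodule.eq_of_le_of_finrank_eq hle (by omega)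

/-- Membership in the closure means that adding `e` does not raise the rank, and nested subspaces of
equal codimension coincide. -/
theorem LabArrangement.mem_closure_matroid_iff {F V ι : Type*} [Field F] [AddCommGroup V]
    [Module F V] [FiniteDimensional F V] [Finite ι] (𝓚 : LabArrangement F V ι) (X : Set ι) (e : ι) :
    e ∈ 𝓚.matroid.closure X ↔ (⨅ i ∈ X, 𝓚.hyp i) ≤ 𝓚.hyp e := by
  have hins : (⨅ i ∈ insert e X, 𝓚.hyp i) = 𝓚.hyp e ⊓ ⨅ i ∈ X, 𝓚.hyp i := iInf_insert
  constructor
  · intro he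
    have h1 : 𝓚.matroid.eRk (insert e X) = 𝓚.matroid.eRk X := by
      rw [← Matroid.eRk_closure_eq, Matroid.closure_insert_eq_of_mem_closure he,
        Matroid.eRk_closure_eq]
    rw [𝓚.eRk_matroid, 𝓚.eRk_matroid, Nat.cast_inj, hins] at h1
    exact inf_eq_right.1 (codim_inj_of_le inf_le_right h1)
  · intro hle
    by_contra he
    have h1 := Matroid.eRk_insert_eq_add_one (M := 𝓚.matroid) (X := X) ⟨mem_univ e, he⟩
    rw [𝓚.eRk_matroid, 𝓚.eRk_matroid, hins, inf_eq_right.2 hle] at h1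
    have h2 : codim (⨅ i ∈ X, 𝓚.hyp i) = codim (⨅ i ∈ X, 𝓚.hyp i) + 1 := by exact_mod_cast h1
    omega

theorem LabArrangement.setOf_le_hyp_subset_iff {F V ι : Type*} [Field F] [AddCommGroup V]
    [Module F V] (𝓚 : LabArrangement F V ι) {𝓢 : Set (Submodule F V)}
    (h𝓢 : 𝓢 ⊆ Set.range 𝓚.hyp) (W : Submodule F V) :
    {e | sInf 𝓢 ≤ 𝓚.hyp e} ⊆ {e | W ≤ 𝓚.hyp e} ↔ W ≤ sInf 𝓢 := by
  constructor
  · intro hle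
    refine le_sInf fun H hH => ?_
    obtain ⟨e, rfl⟩ := h𝓢 hH
    exact hle (show sInf 𝓢 ≤ 𝓚.hyp e from sInf_le hH)
  · intro hle e he
    exact hle.trans he

theorem LabArrangement.isFlat_setOf_le_hyp {F V ι : Type*} [Field F] [AddCommGroup V] [Module F V]
    [FiniteDimensional F V] [Finite ι] (𝓚 : LabArrangement F V ι) (W : Submodule F V) :
    𝓚.matroid.IsFlat {e | W ≤ 𝓚.hyp e} := by
  have hE : {e | W ≤ 𝓚.hyp e} ⊆ 𝓚.matroid.E := by rw [𝓚.matroid_ground]; exact subset_univ _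
  rw [Matroid.isFlat_iff_closure_eq]
  refine Subset.antisymm (fun e he => ?_) (Matroid.subset_closure _ _ hE)
  have hW : W ≤ ⨅ i ∈ {e | W ≤ 𝓚.hyp e}, 𝓚.hyp i := le_iInf₂ fun i hi => hi
  exact hW.trans ((𝓚.mem_closure_matroid_iff _ e).1 he)

/-- The intersection lattice of an arrangement is isomorphic to the lattice of flats of the matroid
of any labelling of it. -/
noncomputable def LabArrangement.latticeIso {F V ι : Type*} [Field F] [AddCommGroup V] [Module F V]
    [FiniteDimensional F V] [Finite ι] (𝓚 : LabArrangement F V ι) (𝓗 : HypArrangement F V)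
    (h : 𝓗.hyps = Set.range 𝓚.hyp \ {⊤}) :
    𝓗.IntersectionLattice ≃o {X : Set ι // 𝓚.matroid.IsFlat X} where
  toFun W := ⟨{e | (OrderDual.ofDual W).1 ≤ 𝓚.hyp e}, 𝓚.isFlat_setOf_le_hyp _⟩
  -- A flat contains all loops; their label is the whole space, which is not a member of `𝓗` and is
  -- discarded.
  invFun X := OrderDual.toDual ⟨⨅ e ∈ X.1, 𝓚.hyp e, 𝓚.hyp '' X.1 \ {⊤},
    by rw [h]; exact sdiff_subset_sdiff_left (image_subset_range _ _),
    by rw [sInf_sdiff_singleton_top, sInf_image]⟩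
  left_inv W := by
    obtain ⟨W, rfl⟩ := OrderDual.toDual.surjective W
    obtain ⟨W, 𝓢, h𝓢, rfl⟩ := W
    refine congrArg OrderDual.toDual (Subtype.ext (le_antisymm ?_ (le_iInf₂ fun i hi => hi)))
    refine le_sInf fun H hH => ?_
    obtain ⟨⟨e, rfl⟩, -⟩ := (h ▸ h𝓢) hH
    exact iInf₂_le e (show sInf 𝓢 ≤ 𝓚.hyp e from sInf_le hH)
  right_inv X := by
    refine Subtype.ext (Set.ext fun e => ?_)
    conv_rhs => rw [← X.2.closure]
    exact (𝓚.mem_closure_matroid_iff X.1 e).symm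
  map_rel_iff' {W₁ W₂} := by
    obtain ⟨W₁, rfl⟩ := OrderDual.toDual.surjective W₁
    obtain ⟨W₂, rfl⟩ := OrderDual.toDual.surjective W₂
    obtain ⟨W₁, 𝓢, h𝓢, rfl⟩ := W₁
    exact 𝓚.setOf_le_hyp_subset_iff ((h ▸ h𝓢).trans sdiff_subset) W₂.1

theorem exists_latticeIso_labelsContaining {F : Type*} [Field F] {m : ℕ}
    (S : Submodule F (Fin m → F)) (M : Matroid (Fin m))
    (hM : M = ((labCoordArrangement F m).trace S).matroid) :
    ∃ φ : ((coordArrangement F m).induced S).IntersectionLattice ≃o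
        {X : Set (Fin m) // M.IsFlat X},
      (∀ W, (φ W : Set (Fin m)) = labelsContaining (OrderDual.ofDual W).1) ∧
      (∀ X, (OrderDual.ofDual (φ.symm X)).1 =
        ⨅ e ∈ X.1, ((labCoordArrangement F m).trace S).hyp e) := by
  subst hM
  refine ⟨((labCoordArrangement F m).trace S).latticeIso _ (hyps_induced_coordArrangement F m S),
    fun W => ?_, fun X => rfl⟩
  ext e
  exact Submodule.map_le_iff_le_comap.symm

end ArrangementMatroids

/-! ### Gordan's theorem and its signed form for a subspace and its orthogonal. -/

section Alternative

theorem exists_mul_add_pos {F ι : Type*} [Field F] [LinearOrder F] [IsStrictOrderedRing F]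
    (s : Finset ι) (a b : ι → F) (ha : ∀ i ∈ s, 0 < a i) :
    ∃ N : F, 0 < N ∧ ∀ i ∈ s, 0 < N * a i + b i := by
  have hnn : ∀ i ∈ s, 0 ≤ |b i| / a i := fun i hi => div_nonneg (abs_nonneg _) (ha i hi).le
  have hsum := Finset.sum_nonneg hnn
  -- The sum replaces a maximum of the ratios, and the extra 1 makes the inequality strict.
  refine ⟨1 + ∑ i ∈ s, |b i| / a i, by linarith, fun i hi => ?_⟩
  have h1 : |b i| ≤ (∑ i ∈ s, |b i| / a i) * a i :=
    (div_le_iff₀ (ha i hi)).1 (Finset.single_le_sum hnn hi)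
  have h2 := neg_abs_le (b i)
  have h3 := ha i hi
  rw [add_mul, one_mul]
  linarith

/-- **Gordan's theorem** over an ordered field, for finitely many linear functionals restricted to
a subspace. -/
theorem exists_forall_pos_or_exists_nonneg_relation {F V ι : Type*} [Field F] [LinearOrder F]
    [IsStrictOrderedRing F] [AddCommGroup V] [Module F V] (f : ι → Module.Dual F V)
    (s : Finset ι) (W : Submodule F V) :
    (∃ x ∈ W, ∀ i ∈ s, 0 < f i x) ∨
      ∃ l : ι → F, (∀ i, 0 ≤ l i) ∧ (∃ i ∈ s, l i ≠ 0) ∧ ∀ x ∈ W, ∑ i ∈ s, l i * f i x = 0 := by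
  classical
  -- The subspace varies because the induction hypothesis is also applied to `W ∩ ker (f a)`.
  induction s using Finset.induction_on generalizing W with
  | empty => exact Or.inl ⟨0, W.zero_mem, by simp⟩
  | insert a s ha ih =>
    have key : ∀ (c : F) (l : ι → F) (x : V),
        ∑ i ∈ insert a s, (Function.update l a c) i * f i x = c * f a x + ∑ i ∈ s, l i * f i x := by
      intro c l x
      rw [Finset.sum_insert ha, Function.update_self]
      congr 1
      refine Finset.sum_congr rfl fun i hi => ?_
      rw [Function.update_of_ne (by rintro rfl; exact ha hi)]
    have hupd : ∀ (c : F) (l : ι → F), 0 ≤ c → (∀ i, 0 ≤ l i) →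
        ∀ i, 0 ≤ Function.update l a c i := by
      intro c l hc hl i
      by_cases hi : i = a
      · subst hi; rwa [Function.update_self]
      · rw [Function.update_of_ne hi]; exact hl i
    have hne : ∀ (c : F) (l : ι → F), (∃ i ∈ s, l i ≠ 0) →
        ∃ i ∈ insert a s, Function.update l a c i ≠ 0 := by
      rintro c l ⟨i, hi, hli⟩
      refine ⟨i, Finset.mem_insert_of_mem hi, ?_⟩
      rwa [Function.update_of_ne (by rintro rfl; exact ha hi)]
    rcases ih W with ⟨x₀, hx₀, hpos⟩ | ⟨l, hl, hl0, hrel⟩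
    swap
    · refine Or.inr ⟨Function.update l a 0, hupd 0 l le_rfl hl, hne 0 l hl0, fun x hx => ?_⟩
      rw [key, hrel x hx, zero_mul, zero_add]
    by_cases hfa : ∀ x ∈ W, f a x = 0
    · refine Or.inr ⟨Function.update 0 a 1, hupd 1 0 zero_le_one fun _ => le_rfl,
        ⟨a, Finset.mem_insert_self a s, by simp⟩, fun x hx => ?_⟩
      rw [key, hfa x hx]
      simp
    push Not at hfa
    obtain ⟨v, hv, hfav⟩ : ∃ v ∈ W, f a v = 1 := by
      obtain ⟨v, hv, h0⟩ := hfa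
      exact ⟨(f a v)⁻¹ • v, W.smul_mem _ hv, by simp [h0]⟩
    rcases ih (W ⊓ LinearMap.ker (f a)) with ⟨x, ⟨hx, hxa⟩, hxs⟩ | ⟨l, hl, hl0, hrel⟩
    -- Here `x` makes the old functionals positive while `f a x = 0`. Adding `v` makes `f a` equal
    -- to 1, and a large multiple of `x` keeps the others positive.
    · obtain ⟨N, -, hN⟩ := exists_mul_add_pos s (fun i => f i x) (fun i => f i v) hxs
      refine Or.inl ⟨N • x + v, W.add_mem (W.smul_mem N hx) hv, fun i hi => ?_⟩
      rw [map_add, map_smul, smul_eq_mul]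
      rcases Finset.mem_insert.1 hi with rfl | hi
      · rw [LinearMap.mem_ker.1 hxa, hfav, mul_zero, zero_add]
        exact one_pos
      · exact hN i hi
    · set c := ∑ i ∈ s, l i * f i v with hc
      -- A combination that vanishes on `W ∩ ker (f a)` is a multiple of `f a` on `W`; evaluation at
      -- `v` gives the factor `c`.
      have hsum : ∀ x ∈ W, ∑ i ∈ s, l i * f i x = c * f a x := by
        intro x hx
        have h1 := hrel (x - f a x • v) ⟨W.sub_mem hx (W.smul_mem _ hv), by simp [hfav]⟩
        have h2 : ∑ i ∈ s, l i * f i (x - f a x • v) =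
            ∑ i ∈ s, l i * f i x - f a x * ∑ i ∈ s, l i * f i v := by
          rw [Finset.mul_sum, ← Finset.sum_sub_distrib]
          refine Finset.sum_congr rfl fun i _ => ?_
          rw [map_sub, map_smul, smul_eq_mul]
          ring
        rw [h2, ← hc] at h1
        linarith
      -- If `c ≤ 0`, moving `c * f a` to the other side gives a nonnegative relation. If `c > 0`,
      -- the point `x₀` found before already has `f a x₀ > 0`, because the combination is positive
      -- there.
      rcases le_or_gt c 0 with hc0 | hc0
      · refine Or.inr ⟨Function.update l a (-c), hupd _ l (neg_nonneg.2 hc0) hl, hne _ l hl0,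
          fun x hx => ?_⟩
        rw [key, hsum x hx]
        ring
      · refine Or.inl ⟨x₀, hx₀, fun i hi => ?_⟩
        rcases Finset.mem_insert.1 hi with rfl | hi
        · have h1 : 0 < ∑ j ∈ s, l j * f j x₀ := by
            obtain ⟨j, hj, hlj⟩ := hl0
            exact Finset.sum_pos' (fun j hj => mul_nonneg (hl j) (hpos j hj).le)
              ⟨j, hj, mul_pos ((hl j).lt_of_ne' hlj) (hpos j hj)⟩
          rw [hsum x₀ hx₀] at h1
          exact pos_of_mul_pos_right h1 hc0.le
        · exact hpos i hi

open Classical in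
/-- The factor by which reversing the elements of `T` multiplies the coordinate `e`. -/
noncomputable def signFactor (F : Type*) {E : Type*} [Field F] (T : Set E) (e : E) : F :=
  if e ∈ T then -1 else 1

theorem signFactor_mul_self {F E : Type*} [Field F] (T : Set E) (e : E) :
    signFactor F T e * signFactor F T e = 1 := by
  by_cases h : e ∈ T <;> simp [signFactor, h]

theorem signFactor_ne_zero {F E : Type*} [Field F] (T : Set E) (e : E) :
    signFactor F T e ≠ 0 := by
  by_cases h : e ∈ T <;> simp [signFactor, h]

theorem flip_sign {F E : Type*} [Field F] [LinearOrder F] [IsStrictOrderedRing F] (T : Set E)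
    (x : E → F) (e : E) :
    OrientedMatroid.flip T (fun f => SignType.sign (x f)) e =
      SignType.sign (signFactor F T e * x e) := by
  by_cases h : e ∈ T <;> simp [signFactor, OrientedMatroid.flip, h, Left.sign_neg]

/-- Thus a vector determines the set `T` for which it is positive after reversal, which links
regions with orientations. -/
theorem forall_signFactor_mul_pos_iff {F E : Type*} [Field F] [LinearOrder F]
    [IsStrictOrderedRing F] (T : Set E) (x : E → F) :
    (∀ e, 0 < signFactor F T e * x e) ↔ (∀ e, x e ≠ 0) ∧ T = {e | x e < 0} := by
  constructor
  · intro h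
    refine ⟨fun e he => by simpa [he] using h e, Set.ext fun e => ?_⟩
    have h1 := h e
    by_cases he : e ∈ T <;> simp [signFactor, he] at h1 ⊢
    · exact h1
    · exact h1.le
  · rintro ⟨h0, rfl⟩ e
    by_cases he : x e < 0
    · simp [signFactor, he]
    · simpa [signFactor, he] using lt_of_le_of_ne (not_lt.1 he) (h0 e).symm

/-- Gordan's theorem is applied on `W⊥` to the coordinate functionals with the signs of `T`. The
coefficients of a nonnegative relation, given the same signs, form a vector of `W⊥⊥ = W`. -/
theorem exists_orthSpace_pos_or_exists_nonneg {F ι : Type*} [Field F] [LinearOrder F]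
    [IsStrictOrderedRing F] [Fintype ι] (W : Submodule F (ι → F)) (T : Set ι) :
    (∃ x ∈ orthSpace W, ∀ e, 0 < signFactor F T e * x e) ∨
      ∃ z ∈ W, z ≠ 0 ∧ ∀ e, 0 ≤ signFactor F T e * z e := by
  rcases exists_forall_pos_or_exists_nonneg_relation
    (fun e => signFactor F T e • (LinearMap.proj e : (ι → F) →ₗ[F] F)) Finset.univ (orthSpace W)
    with ⟨x, hx, hpos⟩ | ⟨l, hl, ⟨e, -, he⟩, hrel⟩
  · exact Or.inl ⟨x, hx, fun e => hpos e (Finset.mem_univ e)⟩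
  · refine Or.inr ⟨fun i => signFactor F T i * l i, ?_, ?_, fun i => ?_⟩
    · rw [← orthSpace_orthSpace W]
      intro x hx
      rw [← hrel x hx]
      refine Finset.sum_congr rfl fun i _ => ?_
      simp
      ring
    · intro h
      exact mul_ne_zero (signFactor_ne_zero T e) he (congrFun h e)
    · rw [← mul_assoc, signFactor_mul_self, one_mul]
      exact hl i

/-- The signs cancel in each product `x e * z e`, so `x ⬝ᵥ z = 0` is a sum of nonnegative terms,
each of which must vanish. -/
theorem not_exists_nonneg_of_orthSpace_pos {F ι : Type*} [Field F] [LinearOrder F]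
    [IsStrictOrderedRing F] [Fintype ι] {W : Submodule F (ι → F)} {T : Set ι} {x z : ι → F}
    (hx : x ∈ orthSpace W) (hpos : ∀ e, 0 < signFactor F T e * x e) (hz : z ∈ W)
    (hnn : ∀ e, 0 ≤ signFactor F T e * z e) : z = 0 := by
  have hterm : ∀ e, x e * z e = (signFactor F T e * x e) * (signFactor F T e * z e) := by
    intro e
    linear_combination (-(x e * z e)) * signFactor_mul_self (F := F) T e
  have h1 : ∑ e, x e * z e = 0 := hx z hz
  rw [Finset.sum_eq_zero_iff_of_nonneg fun e _ => by
    rw [hterm]; exact mul_nonneg (hpos e).le (hnn e)] at h1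
  ext e
  have hxe : x e ≠ 0 := fun h => by simpa [h] using hpos e
  exact (mul_eq_zero.1 (h1 e (Finset.mem_univ e))).resolve_left hxe

end Alternative

/-! ### Acyclic and totally cyclic reorientations in terms of positive vectors. -/

section Orientations

theorem signFactor_mul_nonneg_of_conformal {F E : Type*} [Field F] [LinearOrder F]
    [IsStrictOrderedRing F] {T : Set E} {w z : E → F}
    (hw : ∀ f, SignType.sign (w f) = 0 ∨ SignType.sign (w f) = SignType.sign (z f))
    (hz : ∀ e, 0 ≤ signFactor F T e * z e) (e : E) : 0 ≤ signFactor F T e * w e := by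
  rw [← sign_nonneg_iff, sign_mul]
  rcases hw e with h | h
  · rw [h, mul_zero]
  · rw [h, ← sign_mul, sign_nonneg_iff]
    exact hz e

/-- By the alternative, failure to find `x` produces a nonzero nonnegative vector of `W`, and an
elementary vector conforming to it is a positive circuit. -/
theorem isAcyclic_reorient_ofSubspace_iff {F ι : Type*} [Field F] [LinearOrder F]
    [IsStrictOrderedRing F] [Fintype ι] (W : Submodule F (ι → F)) (T : Set ι) :
    ((OrientedMatroid.ofSubspace W).reorient T).IsAcyclic ↔
      ∃ x ∈ orthSpace W, ∀ e, 0 < signFactor F T e * x e := by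
  constructor
  · intro h
    refine (exists_orthSpace_pos_or_exists_nonneg W T).resolve_right ?_
    rintro ⟨z, hz, hz0, hnn⟩
    obtain ⟨w, hw, hwz⟩ := exists_conformal_elementary W _ z rfl hz hz0
    refine h ⟨_, ⟨_, ⟨w, hw, rfl⟩, rfl⟩, fun e => ?_⟩
    rw [flip_sign, sign_nonneg_iff]
    exact signFactor_mul_nonneg_of_conformal hwz hnn e
  · rintro ⟨x, hx, hpos⟩ ⟨_, ⟨_, ⟨w, hw, rfl⟩, rfl⟩, hnn⟩
    simp only [flip_sign, sign_nonneg_iff] at hnn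
    exact hw.2.1 (not_exists_nonneg_of_orthSpace_pos hx hpos hw.1 hnn)

/-- A vector of `W` with nonnegative coordinates (up to the reversal of `T`) that is positive at `e`
can be replaced by an elementary one. -/
theorem exists_isElementary_nonneg {F ι : Type*} [Field F] [LinearOrder F] [IsStrictOrderedRing F]
    [Finite ι] (W : Submodule F (ι → F)) (T : Set ι) (e : ι) {z : ι → F} (hz : z ∈ W)
    (hnn : ∀ f, 0 ≤ signFactor F T f * z f) (hze : z e ≠ 0) :
    ∃ w, IsElementary W w ∧ (∀ f, 0 ≤ signFactor F T f * w f) ∧ w e ≠ 0 := by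
  classical
  have := Fintype.ofFinite ι
  induction hk : (Function.support z).ncard using Nat.strong_induction_on generalizing z with
  | _ k ih =>
    have hz0 : z ≠ 0 := fun h => hze (by simp [h])
    obtain ⟨w, hw, hwz⟩ := exists_conformal_elementary W _ z rfl hz hz0
    have hwnn := signFactor_mul_nonneg_of_conformal hwz hnn
    -- If `w` misses `e`, subtracting a multiple of `w` leaves the coordinate at `e` intact and can
    -- be used to shrink the support of `z`.
    by_cases hwe : w e ≠ 0
    · exact ⟨w, hw, hwnn, hwe⟩
    rw [not_not] at hwe
    have hsupp : ∀ f, z f = 0 → w f = 0 := by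
      intro f hf
      rcases hwz f with h | h
      · exact sign_eq_zero_iff.1 h
      · rw [hf, sign_zero] at h
        exact sign_eq_zero_iff.1 h
    have hwpos : ∀ f, w f ≠ 0 → 0 < signFactor F T f * w f := fun f hf =>
      (hwnn f).lt_of_ne' (mul_ne_zero (signFactor_ne_zero T f) hf)
    obtain ⟨g, hg⟩ := Function.ne_iff.1 hw.2.1
    obtain ⟨f₀, hf₀, hmin⟩ := Finset.exists_min_image (Finset.univ.filter fun f => w f ≠ 0)
      (fun f => (signFactor F T f * z f) / (signFactor F T f * w f)) ⟨g, by simpa using hg⟩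
    simp only [Finset.mem_filter, Finset.mem_univ, true_and] at hf₀ hmin
    -- The smallest ratio over the support of `w`: the largest `t` for which `z - t • w` stays
    -- nonnegative after reversal. The coordinate `f₀` becomes zero.
    set t := (signFactor F T f₀ * z f₀) / (signFactor F T f₀ * w f₀) with ht
    have ht' : t = z f₀ / w f₀ := mul_div_mul_left _ _ (signFactor_ne_zero T f₀)
    have hval : ∀ f, (z - t • w) f = z f - t * w f := fun f => rfl
    have h0 : (z - t • w) f₀ = 0 := by
      rw [hval, ht', div_mul_cancel₀ _ hf₀, sub_self]
    refine ih _ ?_ (W.sub_mem hz (W.smul_mem t hw.1)) (fun f => ?_) ?_ rfl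
    · rw [← hk]
      refine Set.ncard_lt_ncard ⟨?_, ?_⟩ (Set.toFinite _)
      · intro f hf hzf
        exact hf (by rw [hval, hzf, hsupp f hzf, mul_zero, sub_zero])
      · intro h
        exact h (show f₀ ∈ Function.support z from fun hzf => hf₀ (hsupp f₀ hzf)) h0
    · rw [hval]
      by_cases hwf : w f = 0
      · rw [hwf, mul_zero, sub_zero]
        exact hnn f
      · have h1 := (le_div_iff₀ (hwpos f hwf)).1 (hmin f hwf)
        linarith
    · rw [hval, hwe, mul_zero, sub_zero]
      exact hze

theorem isTotallyCyclic_reorient_ofSubspace_iff {F ι : Type*} [Field F] [LinearOrder F]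
    [IsStrictOrderedRing F] [Fintype ι] (W : Submodule F (ι → F)) (T : Set ι) :
    ((OrientedMatroid.ofSubspace W).reorient T).IsTotallyCyclic ↔
      ∃ x ∈ W, ∀ e, 0 < signFactor F T e * x e := by
  constructor
  · intro h
    have h1 : ∀ e, ∃ w ∈ W, (∀ f, 0 ≤ signFactor F T f * w f) ∧ w e ≠ 0 := by
      intro e
      obtain ⟨_, ⟨_, ⟨w, hw, rfl⟩, rfl⟩, hnn, he⟩ := h e
      simp only [flip_sign, sign_nonneg_iff] at hnn
      refine ⟨w, hw.1, hnn, fun h0 => he ?_⟩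
      rw [flip_sign, h0, mul_zero, sign_zero]
    choose w hwW hwnn hwe using h1
    -- One positive circuit through each element; in their sum nothing cancels, and the summand
    -- chosen for `e` makes coordinate `e` positive.
    refine ⟨∑ f, w f, W.sum_mem fun f _ => hwW f, fun e => ?_⟩
    rw [Finset.sum_apply, Finset.mul_sum]
    exact Finset.sum_pos' (fun f _ => hwnn f e) ⟨e, Finset.mem_univ e,
      (hwnn e e).lt_of_ne' (mul_ne_zero (signFactor_ne_zero T e) (hwe e))⟩
  · rintro ⟨x, hx, hpos⟩ e
    obtain ⟨w, hw, hnn, hwe⟩ := exists_isElementary_nonneg W T e hx (fun f => (hpos f).le)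
      (fun h => by simpa [h] using hpos e)
    refine ⟨_, ⟨_, ⟨w, hw, rfl⟩, rfl⟩, fun f => ?_, ?_⟩
    · rw [flip_sign, sign_nonneg_iff]
      exact hnn f
    · rw [flip_sign, Ne, sign_eq_zero_iff]
      exact mul_ne_zero (signFactor_ne_zero T e) hwe

end Orientations

/-! ### Regions as sign patterns. -/

section CoordinateRegions

variable {F : Type*} [Field F] {m : ℕ} {S : Submodule F (Fin m → F)}

theorem mem_arrangementComplement_trace {x : S} :
    x ∈ arrangementComplement (Set.range ((labCoordArrangement F m).trace S).hyp) ↔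
      ∀ e, (x : Fin m → F) e ≠ 0 := by
  rw [arrangementComplement, mem_ofPred_eq, forall_mem_range]
  rfl

theorem segment_subset_arrangementComplement_trace_iff [LinearOrder F] [IsStrictOrderedRing F]
    {x y : S} (hx : ∀ e, (x : Fin m → F) e ≠ 0) (hy : ∀ e, (y : Fin m → F) e ≠ 0) :
    segment F x y ⊆ arrangementComplement (Set.range ((labCoordArrangement F m).trace S).hyp) ↔
      ∀ e, (x : Fin m → F) e < 0 ↔ (y : Fin m → F) e < 0 := by
  have hopp : ∀ {u v : S}, segment F u v ⊆
      arrangementComplement (Set.range ((labCoordArrangement F m).trace S).hyp) →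
      ∀ e, (u : Fin m → F) e < 0 → ¬ 0 < (v : Fin m → F) e := by
    intro u v h e hu hv
    set a := (u : Fin m → F) e
    set b := (v : Fin m → F) e
    have hd : 0 < b - a := by linarith
    -- The point of the segment at which the coordinate `e`, running from `a < 0` to `b > 0`,
    -- vanishes.
    have hmem : (b / (b - a)) • u + (-a / (b - a)) • v ∈ segment F u v :=
      ⟨_, _, div_nonneg hv.le hd.le, div_nonneg (by linarith) hd.le, by field_simp; ring, rfl⟩
    refine mem_arrangementComplement_trace.1 (h hmem) e ?_
    change b / (b - a) * a + -a / (b - a) * b = 0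
    ring
  constructor
  · intro h e
    constructor
    · intro hxe
      exact lt_of_le_of_ne (not_lt.1 (hopp h e hxe)) (hy e)
    · intro hye
      rw [segment_symm] at h
      exact lt_of_le_of_ne (not_lt.1 (hopp h e hye)) (hx e)
  · rintro h _ ⟨a, b, ha, hb, hab, rfl⟩
    refine mem_arrangementComplement_trace.2 fun e => ?_
    change a * (x : Fin m → F) e + b * (y : Fin m → F) e ≠ 0
    rcases lt_or_gt_of_ne (hx e) with hxe | hxe
    · have hye := (h e).1 hxe
      -- With weight zero on `x` the point is `y` itself; otherwise the term from `x` is strictly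
      -- negative and that from `y` is not positive.
      rcases ha.eq_or_lt with rfl | ha
      · have : b = 1 := by linarith
        subst this; linarith
      · nlinarith
    · have hye : 0 < (y : Fin m → F) e :=
        lt_of_le_of_ne (not_lt.1 fun hye => hxe.not_gt ((h e).2 hye)) (hy e).symm
      rcases ha.eq_or_lt with rfl | ha
      · have : b = 1 := by linarith
        subst this; linarith
      · nlinarith

theorem reflTransGen_segment_trace_iff [LinearOrder F] [IsStrictOrderedRing F] {x y : S}
    (hx : ∀ e, (x : Fin m → F) e ≠ 0) :
    Relation.ReflTransGen (fun a b => segment F a b ⊆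
      arrangementComplement (Set.range ((labCoordArrangement F m).trace S).hyp)) x y ↔
      (∀ e, (y : Fin m → F) e ≠ 0) ∧ ∀ e, (x : Fin m → F) e < 0 ↔ (y : Fin m → F) e < 0 := by
  constructor
  · intro h
    induction h with
    | refl => exact ⟨hx, fun e => Iff.rfl⟩
    | @tail b c _ hbc ih =>
      have hc : ∀ e, (c : Fin m → F) e ≠ 0 :=
        mem_arrangementComplement_trace.1 (hbc (right_mem_segment F b c))
      exact ⟨hc, fun e =>
        (ih.2 e).trans ((segment_subset_arrangementComplement_trace_iff ih.1 hc).1 hbc e)⟩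
  · rintro ⟨hy, h⟩
    exact .single ((segment_subset_arrangementComplement_trace_iff hx hy).2 h)

/-- Under `hP` both sides are indexed by the sign patterns of nowhere zero vectors of `S`, so the
acyclic and the totally cyclic case need only their own criterion. -/
theorem regionsCorrespond_trace [LinearOrder F] [IsStrictOrderedRing F]
    {M : OrientedMatroid (Fin m)} {P : OrientedMatroid (Fin m) → Prop}
    (hP : ∀ T, P (M.reorient T) ↔ ∃ x ∈ S, ∀ e, 0 < signFactor F T e * x e) :
    RegionsCorrespond (Set.range ((labCoordArrangement F m).trace S).hyp) M P := by
  set 𝓚 := Set.range ((labCoordArrangement F m).trace S).hyp with h𝓚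
  have hreg : ∀ R : regions 𝓚, ∃ x : S, (∀ e, (x : Fin m → F) e ≠ 0) ∧
      R.1 = {y : S | (∀ e, (y : Fin m → F) e ≠ 0) ∧
        ∀ e, (x : Fin m → F) e < 0 ↔ (y : Fin m → F) e < 0} := by
    rintro ⟨_, x, hx, rfl⟩
    have hx' := mem_arrangementComplement_trace.1 hx
    exact ⟨x, hx', Set.ext fun y => reflTransGen_segment_trace_iff hx'⟩
  -- A representative point of each region; all points of a region have the same negative
  -- coordinates, so the resulting `T` does not depend on it.
  choose p hp hpR using hreg
  have hmem : ∀ R, P (M.reorient {e | (p R : Fin m → F) e < 0}) := fun R =>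
    (hP _).2 ⟨p R, (p R).2, (forall_signFactor_mul_pos_iff _ _).2 ⟨hp R, rfl⟩⟩
  refine ⟨Equiv.ofBijective (fun R => ⟨{e | (p R : Fin m → F) e < 0}, hmem R⟩) ⟨?_, ?_⟩, ?_⟩
  · intro R R' h
    have h1 : ∀ e, (p R : Fin m → F) e < 0 ↔ (p R' : Fin m → F) e < 0 :=
      Set.ext_iff.1 (congrArg Subtype.val h)
    apply Subtype.ext
    rw [hpR, hpR]
    simp only [h1]
  · rintro ⟨T, hT⟩
    obtain ⟨x, hx, hpos⟩ := (hP T).1 hT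
    obtain ⟨h0, rfl⟩ := (forall_signFactor_mul_pos_iff T x).1 hpos
    have hc : (⟨x, hx⟩ : S) ∈ arrangementComplement 𝓚 := mem_arrangementComplement_trace.2 h0
    let R : regions 𝓚 := ⟨_, ⟨x, hx⟩, hc, rfl⟩
    have hxR : (⟨x, hx⟩ : S) ∈ R.1 := Relation.ReflTransGen.refl
    rw [hpR R] at hxR
    exact ⟨R, Subtype.ext (Set.ext hxR.2)⟩
  · intro R x hx e
    rw [hpR R] at hx
    exact hx.2 e

theorem hyps_induced_eq_range_of_forall_not_le (h : ∀ e, ¬ S ≤ coordHyp F e) :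
    ((coordArrangement F m).induced S).hyps =
      Set.range ((labCoordArrangement F m).trace S).hyp := by
  rw [hyps_induced_coordArrangement]
  refine sdiff_singleton_eq_self ?_
  rintro ⟨e, he⟩
  exact h e (Submodule.comap_subtype_eq_top.1 he)

end CoordinateRegions

/-! ### The theorem for the row space and the null space. -/

theorem lemmaL {F : Type*} [Field F] {n m : ℕ} (A : Matrix (Fin n) (Fin m) F) :
    -- (a) row space: the labelled arrangement, and the set of distinct nondegenerate hyperplanes
    (columnMatroid A = ((labCoordArrangement F m).trace (rowSpace A)).matroid ∧
      columnMatroid A = ((coordArrangement F m).induced (rowSpace A)).matroid.comapOn univ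
        ((labCoordArrangement F m).trace (rowSpace A)).hyp) ∧
    -- (a) null space
    (chainGroupMatroid (rowSpace A) = ((labCoordArrangement F m).trace (nullSpace A)).matroid ∧
      chainGroupMatroid (rowSpace A) =
        ((coordArrangement F m).induced (nullSpace A)).matroid.comapOn univ
          ((labCoordArrangement F m).trace (nullSpace A)).hyp ∧
      chainGroupMatroid (rowSpace A) = (columnMatroid A).dual) ∧
    -- (b) row space
    (∃ φ : ((coordArrangement F m).induced (rowSpace A)).IntersectionLattice ≃o
          {X : Set (Fin m) // (columnMatroid A).IsFlat X},
      (∀ W, (φ W : Set (Fin m)) = labelsContaining (OrderDual.ofDual W).1) ∧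
      (∀ X, (OrderDual.ofDual (φ.symm X)).1 =
        ⨅ e ∈ X.1, ((labCoordArrangement F m).trace (rowSpace A)).hyp e)) ∧
    -- (b) null space
    (∃ φ : ((coordArrangement F m).induced (nullSpace A)).IntersectionLattice ≃o
          {X : Set (Fin m) // (chainGroupMatroid (rowSpace A)).IsFlat X},
      (∀ W, (φ W : Set (Fin m)) = labelsContaining (OrderDual.ofDual W).1) ∧
      (∀ X, (OrderDual.ofDual (φ.symm X)).1 =
        ⨅ e ∈ X.1, ((labCoordArrangement F m).trace (nullSpace A)).hyp e)) ∧
    -- (c) regions and orientations over an ordered field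
    (∀ [LinearOrder F] [IsStrictOrderedRing F],
      RegionsCorrespond (Set.range ((labCoordArrangement F m).trace (rowSpace A)).hyp)
        (columnOrientedMatroid A) OrientedMatroid.IsAcyclic ∧
      ((∀ e, ¬ rowSpace A ≤ coordHyp F e) →
        RegionsCorrespond ((coordArrangement F m).induced (rowSpace A)).hyps
          (columnOrientedMatroid A) OrientedMatroid.IsAcyclic) ∧
      RegionsCorrespond (Set.range ((labCoordArrangement F m).trace (nullSpace A)).hyp)
        (columnOrientedMatroid A) OrientedMatroid.IsTotallyCyclic ∧
      ((∀ e, ¬ nullSpace A ≤ coordHyp F e) →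
        RegionsCorrespond ((coordArrangement F m).induced (nullSpace A)).hyps
          (columnOrientedMatroid A) OrientedMatroid.IsTotallyCyclic)) := by
  have hZ : chainGroupMatroid (rowSpace A) =
      ((labCoordArrangement F m).trace (nullSpace A)).matroid := by
    rw [matroid_trace_labCoordArrangement, orthSpace_nullSpace]
  have hU : columnMatroid A = ((labCoordArrangement F m).trace (rowSpace A)).matroid := by
    rw [matroid_trace_labCoordArrangement, orthSpace_rowSpace, columnMatroid_eq_chainGroupMatroid]
  have hcomap : ∀ S : Submodule F (Fin m → F), ((labCoordArrangement F m).trace S).matroid =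
      ((coordArrangement F m).induced S).matroid.comapOn univ
        ((labCoordArrangement F m).trace S).hyp :=
    fun S => LabArrangement.matroid_eq_comapOn _ _ (hyps_induced_coordArrangement F m S)
  refine ⟨⟨hU, hU.trans (hcomap _)⟩, ⟨hZ, hZ.trans (hcomap _), ?_⟩,
    exists_latticeIso_labelsContaining _ _ hU, exists_latticeIso_labelsContaining _ _ hZ, ?_⟩
  -- The dual of `M(A) = N(Z)` is `N(Z⊥) = N(U)`.
  · rw [columnMatroid_eq_chainGroupMatroid, ← chainGroupMatroid_orthSpace, orthSpace_nullSpace]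
  · intro _ _
    have hAc : RegionsCorrespond (Set.range ((labCoordArrangement F m).trace (rowSpace A)).hyp)
        (columnOrientedMatroid A) OrientedMatroid.IsAcyclic :=
      regionsCorrespond_trace fun T => by
        rw [columnOrientedMatroid, isAcyclic_reorient_ofSubspace_iff, orthSpace_nullSpace]
    have hTc : RegionsCorrespond (Set.range ((labCoordArrangement F m).trace (nullSpace A)).hyp)
        (columnOrientedMatroid A) OrientedMatroid.IsTotallyCyclic :=
      regionsCorrespond_trace fun T => isTotallyCyclic_reorient_ofSubspace_iff (nullSpace A) T
    refine ⟨hAc, fun h => ?_, hTc, fun h => ?_⟩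
    · rwa [hyps_induced_eq_range_of_forall_not_le h]
    · rwa [hyps_induced_eq_range_of_forall_not_le h]
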